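/- Let $k\ge 1$ and $D$ be integers. A complex plane algebraic curve is a set $\gamma=\{(x,y)\in\mathbb{C}^2 : P(x,y)=0\}$ with $P\in\mathbb{C}[x,y]$ non-zero; choosing $P$ square-free, the degree of $\gamma$ is $\deg P$, and $p\in\gamma$ is a smooth point if $\nabla P(p)\neq 0$. The curve is irreducible if it is the zero set of an irreducible polynomial. Let $p$ be a smooth point of two curves $\gamma$ and $\tilde\gamma$. Apply a rotation of $\mathbb{C}^2$ so that neither curve has a vertical tangent at $p=(x,y)$, and parameterize the curves near $p$ as $(t,h(t))$ and $(t,\tilde h(t))$ with $h,\tilde h$ holomorphic near $x$. We say that $\gamma$ and $\tilde\gamma$ are tangent at $p$ to order $\ge k$ if $|h(t)-\tilde h(t)|=O(|t-x|^{k+1})$ as $t\to x$, that is, if $h$ and $\tilde h$ agree at $x$ together with their first $k$ derivatives. For a finite set $\mathcal{C}$ of curves and $p\in\mathbb{C}^2$, let $m_{k,\mathcal{C}}(p)$ be the number of $\gamma\in\mathcal{C}$ for which there is $\tilde\gamma\in\mathcal{C}$, $\tilde\gamma\ne\gamma$, such that $\gamma$ and $\tilde\gamma$ are tangent at $p$ to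 order $\ge k$. Theorem. There is a constant $K$, depending only on $k$ and $D$, such that for every finite set $\mathcal{C}$ of $n$ irreducible algebraic curves in $\mathbb{C}^2$ of degree at most $D$, only finitely many points $p$ have $m_{k,\mathcal{C}}(p)\neq 0$, and $$\sum_{p\in\mathbb{C}^2} m_{k,\mathcal{C}}(p)\le K\,n^{\frac{k+2}{k+1}}.$$ -/

import Mathlib

open scoped Topology

namespace PlaneCurve

/-- The complex affine plane `ℂ²`. -/
abbrev Plane : Type := Fin 2 → ℂ

/-- The zero set in `ℂ²` of a polynomial in two variables. -/
def zeroSet (P : MvPolynomial (Fin 2) ℂ) : Set Plane :=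
  {p | MvPolynomial.eval p P = 0}

/-- `P` is a square-free (in particular non-zero) polynomial whose zero set is `γ`.
Such a `P` is determined by the curve `γ` up to a non-zero constant factor. -/
def IsReducedEquation (P : MvPolynomial (Fin 2) ℂ) (γ : Set Plane) : Prop :=
  Squarefree P ∧ γ = zeroSet P

/-- An irreducible complex plane algebraic curve: the zero set of an irreducible polynomial. -/
def IsIrreducibleCurve (γ : Set Plane) : Prop :=
  ∃ f : MvPolynomial (Fin 2) ℂ, Irreducible f ∧ γ = zeroSet f

/-- The curve `γ` has degree `d`: it is the zero set of a square-free polynomial of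
total degree `d`. -/
def HasDegree (γ : Set Plane) (d : ℕ) : Prop :=
  ∃ P : MvPolynomial (Fin 2) ℂ, IsReducedEquation P γ ∧ P.totalDegree = d

/-- `p` is a smooth point of `γ`: it lies on `γ`, and the gradient of a square-free equation
of `γ` does not vanish at `p`. -/
def IsSmoothPoint (γ : Set Plane) (p : Plane) : Prop :=
  p ∈ γ ∧ ∃ P : MvPolynomial (Fin 2) ℂ, IsReducedEquation P γ ∧
    ∃ i : Fin 2, MvPolynomial.eval p (MvPolynomial.pderiv i P) ≠ 0

/-- The rotation of `ℂ²` by the angle `θ`. -/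
noncomputable def rotate (θ : ℝ) (p : Plane) : Plane :=
  ![(Real.cos θ : ℂ) * p 0 - (Real.sin θ : ℂ) * p 1,
    (Real.sin θ : ℂ) * p 0 + (Real.cos θ : ℂ) * p 1]

/-- In a neighbourhood of `p`, the set `γ` is the graph `(t, h t)` of a function `h` holomorphic
near `p 0`. At a smooth point of a curve this says that the tangent there is not vertical and
that `h` is the local parameterization. -/
def IsLocalGraph (γ : Set Plane) (p : Plane) (h : ℂ → ℂ) : Prop :=
  AnalyticAt ℂ h (p 0) ∧ ∀ᶠ q in 𝓝 p, (q ∈ γ ↔ q 1 = h (q 0))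

/-- `γ` and `γ'` are tangent at `p` to order `≥ k`: `p` is a smooth point of both and, after a
rotation that makes both tangents at `p` non-vertical, the local parameterizations
`(t, h t)`, `(t, h' t)` of the two curves satisfy `|h t - h' t| = O(|t - x| ^ (k + 1))` as
`t → x`, i.e. `h` and `h'` agree at `x` together with their first `k` derivatives. -/
def TangentToOrder (k : ℕ) (γ γ' : Set Plane) (p : Plane) : Prop :=
  IsSmoothPoint γ p ∧ IsSmoothPoint γ' p ∧
    ∃ (θ : ℝ) (h h' : ℂ → ℂ),
      IsLocalGraph (rotate θ '' γ) (rotate θ p) h ∧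
      IsLocalGraph (rotate θ '' γ') (rotate θ p) h' ∧
      (fun t => h t - h' t) =O[𝓝 (rotate θ p 0)] (fun t => (t - rotate θ p 0) ^ (k + 1))

/-- The number of curves of the finite set `𝒞` that are tangent at `p` to order `≥ k` to some
other curve of `𝒞`. -/
noncomputable def tangencyCount (k : ℕ) (𝒞 : Finset (Set Plane)) (p : Plane) : ℕ :=
  {γ | γ ∈ 𝒞 ∧ ∃ γ' ∈ 𝒞, γ' ≠ γ ∧ TangentToOrder k γ γ' p}.ncard

end PlaneCurve

/-!
The proof is the polynomial method in a jet space. A curve `f(x, y) = 0` lifts, away from its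
points with vertical tangent, to the space of `k`-jets with coordinates `(x, y, y', …, y^(k))`,
and two curves that are tangent to order `≥ k` at `p` have lifts that meet over `p`
(`IsContactArc.jet_eq`). Implicit differentiation makes the lift rational in `x, y` with
denominators powers of `f_y`, so a polynomial of degree `E` on the jet space that does not vanish
on the lift of a curve of bounded degree has `O(E)` zeros there, by a weak Bézout theorem
(`finite_and_ncard_jet_zeros_le`). Counting dimensions, there is a non-zero polynomial `P` of
degree `O(n^(1/(k+1)))` that vanishes on the lifts of all `n` curves (`exists_jetVanishes`).

The local fact that drives the argument is `eval_jet_pderiv_eq_zero`: if `Q` vanishes on the lifts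
of two distinct curves and `z` is the last jet coordinate that occurs in `Q`, then `∂Q/∂z`
vanishes wherever the lifts meet, whatever the exact order of tangency. Replace `P` repeatedly by
its derivative in the last coordinate that still occurs, until only `x` is left; the result is a
non-zero polynomial in `x`, which vanishes on no curve except vertical lines. So every other curve
has a finite rank, the number of derivatives after which the polynomial no longer vanishes on its
lift. The zeros of this first non-vanishing derivative on the lift, together with the points of
vertical tangency, are the exceptional points of the curve; there are `O(n^(1/(k+1)))` of them. If
two lifts meet, the meeting point is exceptional for the curve of smaller rank, and for both
curves if the ranks agree (`mem_exceptionalSet_of_rank_le`). Hence among the curves with a given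
`k`-jet at `p` at most one is not exceptional at `p`, and the sum is at most twice the number of
exceptional pairs (`finite_support_and_finsum_tangencyCount_le`).
-/

namespace PlaneCurve

/-! ### A weak Bézout theorem -/

open Polynomial in
lemma natDegree_resultant_le (f g : ℂ[X][X]) (m n a b : ℕ)
    (hf : ∀ j, (f.coeff j).natDegree ≤ a) (hg : ∀ j, (g.coeff j).natDegree ≤ b) :
    (resultant f g m n).natDegree ≤ m * b + n * a := by
  rw [resultant, Matrix.det_apply]
  refine natDegree_sum_le_of_forall_le _ _ fun s _ => ?_
  have hcol : ∀ j, (sylvester f g m n (s j) j).natDegree ≤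
      Fin.addCases (motive := fun _ => ℕ) (fun _ : Fin m => b) (fun _ : Fin n => a) j := by
    intro j
    induction j using Fin.addCases with
    | left j =>
      simp only [sylvester, Matrix.of_apply, Fin.addCases_left]
      split_ifs
      · exact hg _
      · simp
    | right j =>
      simp only [sylvester, Matrix.of_apply, Fin.addCases_right]
      split_ifs
      · exact hf _
      · simp
  have hprod : (∏ j, sylvester f g m n (s j) j).natDegree ≤ m * b + n * a := by
    refine (natDegree_prod_le _ _).trans ((Finset.sum_le_sum fun j _ => hcol j).trans ?_)
    simp [Fin.sum_univ_add]
  rcases Int.units_eq_one_or (Equiv.Perm.sign s) with h | h <;> simpa [h] using hprod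

/-- A polynomial in two variables, regarded as a polynomial in `y` with coefficients in `ℂ[x]`. -/
noncomputable def toBivariate : MvPolynomial (Fin 2) ℂ ≃ₐ[ℂ] Polynomial (Polynomial ℂ) :=
  (Polynomial.Bivariate.equivMvPolynomial ℂ).symm

lemma toBivariate_monomial (m : Fin 2 →₀ ℕ) (c : ℂ) :
    toBivariate (MvPolynomial.monomial m c) =
      Polynomial.monomial (m 1) (Polynomial.monomial (m 0) c) := by
  rw [MvPolynomial.monomial_eq, Finsupp.prod_fintype _ _ (by simp)]
  simp [toBivariate, Polynomial.Bivariate.equivMvPolynomial_symm_C,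
    Polynomial.Bivariate.equivMvPolynomial_symm_X_0,
    Polynomial.Bivariate.equivMvPolynomial_symm_X_1, ← Polynomial.C_mul_X_pow_eq_monomial,
    mul_assoc]

lemma evalEval_toBivariate (f : MvPolynomial (Fin 2) ℂ) (p : Plane) :
    (toBivariate f).evalEval (p 0) (p 1) = MvPolynomial.eval p f := by
  induction f using MvPolynomial.induction_on' with
  | add f g hf hg => simp [hf, hg]
  | monomial m c =>
    rw [toBivariate_monomial, MvPolynomial.eval_monomial, Finsupp.prod_fintype _ _ (by simp)]
    simp [Polynomial.evalEval, mul_assoc]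

lemma eval_le_totalDegree_of_mem_support {σ : Type*} {f : MvPolynomial σ ℂ} {m : σ →₀ ℕ}
    (hm : m ∈ f.support) (i : σ) : m i ≤ f.totalDegree :=
  (Finsupp.le_degree i m).trans (MvPolynomial.le_totalDegree hm)

lemma natDegree_toBivariate_le (f : MvPolynomial (Fin 2) ℂ) :
    (toBivariate f).natDegree ≤ f.totalDegree := by
  conv_lhs => rw [f.as_sum, map_sum]
  refine Polynomial.natDegree_sum_le_of_forall_le _ _ fun m hm => ?_
  rw [toBivariate_monomial]
  exact (Polynomial.natDegree_monomial_le _).trans (eval_le_totalDegree_of_mem_support hm 1)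

lemma natDegree_coeff_toBivariate_le (f : MvPolynomial (Fin 2) ℂ) (j : ℕ) :
    ((toBivariate f).coeff j).natDegree ≤ f.totalDegree := by
  conv_lhs => rw [f.as_sum, map_sum, Polynomial.finsetSum_coeff]
  refine Polynomial.natDegree_sum_le_of_forall_le _ _ fun m hm => ?_
  rw [toBivariate_monomial, Polynomial.coeff_monomial]
  split_ifs
  · exact (Polynomial.natDegree_monomial_le _).trans (eval_le_totalDegree_of_mem_support hm 0)
  · simp

/-- The polynomial `f` involves `y` exactly when its `y`-derivative is non-zero. -/
lemma natDegree_toBivariate_ne_zero {f : MvPolynomial (Fin 2) ℂ}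
    (hf : MvPolynomial.pderiv 1 f ≠ 0) : (toBivariate f).natDegree ≠ 0 := by
  intro h
  apply hf
  obtain ⟨g, rfl⟩ := (Polynomial.Bivariate.equivMvPolynomial ℂ).surjective f
  rw [Polynomial.Bivariate.pderiv_one_equivMvPolynomial]
  rw [toBivariate, AlgEquiv.symm_apply_apply] at h
  rw [Polynomial.natDegree_eq_zero] at h
  obtain ⟨c, rfl⟩ := h
  simp

lemma isPrimitive_toBivariate {f : MvPolynomial (Fin 2) ℂ} (hf : Irreducible f)
    (hy : MvPolynomial.pderiv 1 f ≠ 0) : (toBivariate f).IsPrimitive :=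
  ((MulEquiv.irreducible_iff toBivariate).2 hf).isPrimitive
    (natDegree_toBivariate_ne_zero hy)

/-- Over a point `x` there is a non-zero equation in `y` : a curve with no vertical line has
finite fibres. -/
lemma map_evalRingHom_toBivariate_ne_zero {f : MvPolynomial (Fin 2) ℂ} (hf : Irreducible f)
    (hy : MvPolynomial.pderiv 1 f ≠ 0) (x : ℂ) :
    (toBivariate f).map (Polynomial.evalRingHom x) ≠ 0 := by
  intro h
  have hdvd : Polynomial.C (Polynomial.X - Polynomial.C x) ∣ toBivariate f := by
    rw [Polynomial.C_dvd_iff_dvd_coeff]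
    intro i
    rw [Polynomial.dvd_iff_isRoot]
    have := congrArg (fun q => q.coeff i) h
    simpa [Polynomial.coeff_map] using this
  exact Polynomial.not_isUnit_X_sub_C x (isPrimitive_toBivariate hf hy _ hdvd)

open Polynomial in
lemma resultant_toBivariate_ne_zero {f g : MvPolynomial (Fin 2) ℂ} (hf : Irreducible f)
    (hy : MvPolynomial.pderiv 1 f ≠ 0) (hfg : ¬ f ∣ g) :
    resultant (toBivariate f) (toBivariate g) ≠ 0 := by
  have hprim := isPrimitive_toBivariate hf hy
  have hirr : Irreducible (toBivariate f) := (MulEquiv.irreducible_iff toBivariate).2 hf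
  have hndvd : ¬ toBivariate f ∣ toBivariate g := fun h => hfg ((map_dvd_iff toBivariate).1 h)
  let K := FractionRing ℂ[X]
  have hirrK := (hprim.irreducible_iff_irreducible_map_fraction_map (K := K)).1 hirr
  have hndvdK := mt (hprim.dvd_iff_fraction_map_dvd_fraction_map (K := K)).2 hndvd
  have hcop := (hirrK.coprime_iff_not_dvd).2 hndvdK
  have hne : resultant ((toBivariate f).map (algebraMap ℂ[X] K))
      ((toBivariate g).map (algebraMap ℂ[X] K)) ≠ 0 := by
    rw [Ne, resultant_eq_zero_iff]
    exact fun h => h.2 hcop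
  have hinj := IsFractionRing.injective ℂ[X] K
  rw [natDegree_map_eq_of_injective hinj, natDegree_map_eq_of_injective hinj,
    resultant_map_map] at hne
  exact fun h => hne (by rw [h, map_zero])

/-- A weak form of Bézout's theorem, with an extra factor `2 * f.totalDegree`: the `x`-coordinates of
the common zeros are roots of the resultant, and each fibre has at most `f.totalDegree` points. -/
theorem finite_and_ncard_common_zeros_le {f g : MvPolynomial (Fin 2) ℂ} (hf : Irreducible f)
    (hy : MvPolynomial.pderiv 1 f ≠ 0) (hfg : ¬ f ∣ g) :
    (zeroSet f ∩ zeroSet g).Finite ∧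
      (zeroSet f ∩ zeroSet g).ncard ≤ 2 * f.totalDegree ^ 2 * g.totalDegree := by
  classical
  set R := Polynomial.resultant (toBivariate f) (toBivariate g) with hR
  have hR0 : R ≠ 0 := resultant_toBivariate_ne_zero hf hy hfg
  have hdeg : R.natDegree ≤ 2 * f.totalDegree * g.totalDegree := by
    refine (natDegree_resultant_le _ _ _ _ _ _ (natDegree_coeff_toBivariate_le f)
      (natDegree_coeff_toBivariate_le g)).trans ?_
    have h1 := Nat.mul_le_mul_right g.totalDegree (natDegree_toBivariate_le f)
    have h2 := Nat.mul_le_mul_right f.totalDegree (natDegree_toBivariate_le g)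
    nlinarith
  let T : Finset (Σ _ : ℂ, ℂ) :=
    R.roots.toFinset.sigma fun x => ((toBivariate f).map (Polynomial.evalRingHom x)).roots.toFinset
  have hT : T.card ≤ 2 * f.totalDegree ^ 2 * g.totalDegree := by
    rw [Finset.card_sigma]
    have h1 : ∀ x, ((toBivariate f).map (Polynomial.evalRingHom x)).roots.toFinset.card ≤
        f.totalDegree := fun x =>
      (Multiset.toFinset_card_le _).trans ((Polynomial.card_roots' _).trans
        (Polynomial.natDegree_map_le.trans (natDegree_toBivariate_le f)))
    have h2 : R.roots.toFinset.card ≤ 2 * f.totalDegree * g.totalDegree :=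
      (Multiset.toFinset_card_le _).trans ((Polynomial.card_roots' _).trans hdeg)
    calc _ ≤ ∑ _x ∈ R.roots.toFinset, f.totalDegree := Finset.sum_le_sum fun x _ => h1 x
      _ = R.roots.toFinset.card * f.totalDegree := by simp
      _ ≤ (2 * f.totalDegree * g.totalDegree) * f.totalDegree := Nat.mul_le_mul_right _ h2
      _ = _ := by ring
  have hsub : zeroSet f ∩ zeroSet g ⊆ (fun s : Σ _ : ℂ, ℂ => (![s.1, s.2] : Plane)) '' T := by
    rintro p ⟨hpf, hpg⟩
    have hpf' : (toBivariate f).evalEval (p 0) (p 1) = 0 := by rw [evalEval_toBivariate]; exact hpf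
    have hpg' : (toBivariate g).evalEval (p 0) (p 1) = 0 := by rw [evalEval_toBivariate]; exact hpg
    refine ⟨⟨p 0, p 1⟩, ?_, ?_⟩
    · simp only [T, Finset.coe_sigma, Set.mem_sigma_iff, Finset.mem_coe, Multiset.mem_toFinset]
      constructor
      · rw [Polynomial.mem_roots hR0, Polynomial.IsRoot]
        obtain ⟨u, v, -, -, huv⟩ := Polynomial.exists_mul_add_mul_eq_C_resultant
          (toBivariate f) (toBivariate g) le_rfl le_rfl (Or.inl (natDegree_toBivariate_ne_zero hy))
        have := congrArg (Polynomial.evalEval (p 0) (p 1)) huv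
        simpa [Polynomial.evalEval_add, Polynomial.evalEval_mul, hpf', hpg', ← hR,
          Polynomial.evalEval_C] using this.symm
      · rw [Polynomial.mem_roots (map_evalRingHom_toBivariate_ne_zero hf hy _), Polynomial.IsRoot,
          Polynomial.map_evalRingHom_eval]
        exact hpf'
    · ext i; fin_cases i <;> rfl
  exact ⟨(T.finite_toSet.image _).subset hsub,
    (Set.ncard_le_ncard hsub (T.finite_toSet.image _)).trans
      ((Set.ncard_image_le T.finite_toSet).trans (by simpa using hT))⟩

/-! ### Equations of irreducible curves and their partial derivatives -/

lemma dvd_pow_of_zeroSet_subset {P f : MvPolynomial (Fin 2) ℂ} (h : zeroSet P ⊆ zeroSet f) :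
    ∃ n : ℕ, P ∣ f ^ n := by
  have hmem : f ∈ (Ideal.span {P}).radical := by
    rw [← MvPolynomial.vanishingIdeal_zeroLocus_eq_radical (K := ℂ),
      MvPolynomial.mem_vanishingIdeal_iff]
    intro x hx
    have hxP := hx P (Ideal.mem_span_singleton_self P)
    rw [MvPolynomial.aeval_eq_eval] at hxP ⊢
    exact h hxP
  obtain ⟨n, hn⟩ := hmem
  exact ⟨n, Ideal.mem_span_singleton.1 hn⟩

lemma associated_of_zeroSet_eq {P f : MvPolynomial (Fin 2) ℂ} (hP : Squarefree P)
    (hf : Irreducible f) (h : zeroSet P = zeroSet f) : Associated P f := by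
  obtain ⟨n, hn⟩ := dvd_pow_of_zeroSet_subset h.le
  obtain ⟨m, hm⟩ := dvd_pow_of_zeroSet_subset h.ge
  have hn0 : n ≠ 0 ∨ IsUnit P := by
    rcases eq_or_ne n 0 with rfl | h0
    · exact Or.inr (isUnit_of_dvd_one (by simpa using hn))
    · exact Or.inl h0
  refine associated_of_dvd_dvd ?_ (hf.prime.dvd_of_dvd_pow hm)
  rcases hn0 with h0 | hu
  · exact (hP.dvd_pow_iff_dvd h0).1 hn
  · exact hu.dvd

lemma exists_irreducible_equation {γ : Set Plane} {d : ℕ} (hγ : IsIrreducibleCurve γ)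
    (hd : HasDegree γ d) :
    ∃ f : MvPolynomial (Fin 2) ℂ, Irreducible f ∧ γ = zeroSet f ∧ f.totalDegree = d := by
  obtain ⟨f, hf, rfl⟩ := hγ
  obtain ⟨P, ⟨hP, hPf⟩, hPd⟩ := hd
  exact ⟨P, (associated_of_zeroSet_eq hP hf hPf.symm).symm.irreducible hf, hPf, hPd⟩

lemma IsSmoothPoint.exists_pderiv_ne_zero {f : MvPolynomial (Fin 2) ℂ} (hf : Irreducible f)
    {p : Plane} (hp : IsSmoothPoint (zeroSet f) p) :
    ∃ i, MvPolynomial.eval p (MvPolynomial.pderiv i f) ≠ 0 := by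
  obtain ⟨hpf, P, ⟨hP, hPf⟩, i, hi⟩ := hp
  obtain ⟨u, rfl⟩ := (associated_of_zeroSet_eq hP hf hPf.symm).symm
  refine ⟨i, fun h => hi ?_⟩
  have hpf' : MvPolynomial.eval p f = 0 := hpf
  rw [MvPolynomial.pderiv_mul, map_add, map_mul, map_mul, h, hpf']
  simp

lemma zeroSet_eq_of_dvd {f g : MvPolynomial (Fin 2) ℂ} (hf : Irreducible f) (hg : Irreducible g)
    (h : f ∣ g) : zeroSet f = zeroSet g := by
  obtain ⟨u, rfl⟩ := hf.associated_of_dvd hg h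
  ext p
  have hu : MvPolynomial.eval p (u : MvPolynomial (Fin 2) ℂ) ≠ 0 :=
    (u.isUnit.map (MvPolynomial.eval p)).ne_zero
  simp [zeroSet, hu]

lemma zeroSet_eq_of_infinite_inter {f g : MvPolynomial (Fin 2) ℂ} (hf : Irreducible f)
    (hy : MvPolynomial.pderiv 1 f ≠ 0) (hg : Irreducible g)
    (h : (zeroSet f ∩ zeroSet g).Infinite) : zeroSet f = zeroSet g := by
  by_contra hne
  exact h (finite_and_ncard_common_zeros_le hf hy fun hd => hne (zeroSet_eq_of_dvd hf hg hd)).1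

/-- An irreducible curve whose equation does not involve `y` is a vertical line. -/
lemma zeroSet_eq_vertical_line {f : MvPolynomial (Fin 2) ℂ} (hf : Irreducible f)
    (hy : MvPolynomial.pderiv 1 f = 0) {p : Plane} (hp : p ∈ zeroSet f) :
    zeroSet f = {q | q 0 = p 0} := by
  -- `f` is constant along vertical lines, so it vanishes on the one through `p`
  have hsub : zeroSet (MvPolynomial.X 0 - MvPolynomial.C (p 0)) ⊆ zeroSet f := by
    intro q hq
    have hq0 : q 0 = p 0 := by simpa [zeroSet, sub_eq_zero] using hq
    have hp' : MvPolynomial.eval p f = 0 := hp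
    obtain ⟨g, rfl⟩ := (Polynomial.Bivariate.equivMvPolynomial ℂ).surjective f
    rw [Polynomial.Bivariate.pderiv_one_equivMvPolynomial, EmbeddingLike.map_eq_zero_iff] at hy
    obtain ⟨c, rfl⟩ : ∃ c, g = Polynomial.C c :=
      ⟨_, Polynomial.eq_C_of_derivative_eq_zero hy⟩
    rw [← evalEval_toBivariate, toBivariate, AlgEquiv.symm_apply_apply,
      Polynomial.evalEval_C] at hp'
    change MvPolynomial.eval q _ = 0
    rw [← evalEval_toBivariate, toBivariate, AlgEquiv.symm_apply_apply, Polynomial.evalEval_C, hq0,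
      hp']
  obtain ⟨n, hn⟩ := dvd_pow_of_zeroSet_subset hsub
  have hnu : ¬ IsUnit (MvPolynomial.X 0 - MvPolynomial.C (p 0) : MvPolynomial (Fin 2) ℂ) := by
    intro hu
    have := (hu.map (MvPolynomial.eval p)).ne_zero
    simp at this
  have hne : (MvPolynomial.X 0 - MvPolynomial.C (p 0) : MvPolynomial (Fin 2) ℂ) ≠ 0 := by
    intro h0
    have := congrArg (MvPolynomial.eval (fun _ => p 0 + 1)) h0
    simp at this
  obtain ⟨q, hq, hqd⟩ := WfDvdMonoid.exists_irreducible_factor hnu hne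
  have hqf := hq.associated_of_dvd hf (hq.prime.dvd_of_dvd_pow (hqd.trans hn))
  refine Set.Subset.antisymm (fun r hr => ?_) fun r hr => hsub ?_
  · obtain ⟨w, hw⟩ := hqf.symm.dvd.trans hqd
    have hr' : MvPolynomial.eval r f = 0 := hr
    have := congrArg (MvPolynomial.eval r) hw
    simpa [hr', sub_eq_zero] using this
  · have hr0 : r 0 = p 0 := hr
    simp [zeroSet, hr0]

lemma totalDegree_pderiv_add_one_le {σ : Type*} (i : σ) {f : MvPolynomial σ ℂ}
    (h : MvPolynomial.pderiv i f ≠ 0) :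
    (MvPolynomial.pderiv i f).totalDegree + 1 ≤ f.totalDegree := by
  classical
  obtain ⟨m, hm, hdeg⟩ : ∃ m ∈ (MvPolynomial.pderiv i f).support,
      (MvPolynomial.pderiv i f).totalDegree = m.degree :=
    Finset.exists_mem_eq_sup _ (MvPolynomial.support_nonempty.2 h) _
  rw [hdeg]
  have hm' : m + Finsupp.single i 1 ∈ f.support := by
    rw [MvPolynomial.mem_support_iff, MvPolynomial.coeff_pderiv] at hm
    exact MvPolynomial.mem_support_iff.2 (left_ne_zero_of_mul hm)
  have := MvPolynomial.le_totalDegree hm'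
  calc m.degree + 1 = (m + Finsupp.single i 1).degree := by simp
    _ ≤ _ := this

lemma totalDegree_pderiv_le {σ : Type*} (i : σ) (f : MvPolynomial σ ℂ) :
    (MvPolynomial.pderiv i f).totalDegree ≤ f.totalDegree := by
  by_cases h : MvPolynomial.pderiv i f = 0
  · simp [h]
  · exact (Nat.le_succ _).trans (totalDegree_pderiv_add_one_le i h)

lemma pderiv_ne_zero_of_mem_vars {σ : Type*} {i : σ} {f : MvPolynomial σ ℂ} (h : i ∈ f.vars) :
    MvPolynomial.pderiv i f ≠ 0 := by
  classical
  obtain ⟨m, hm, him⟩ := (MvPolynomial.mem_vars_iff_mem_support _).1 h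
  intro h0
  have h1 : 1 ≤ m i := Nat.one_le_iff_ne_zero.2 (Finsupp.mem_support_iff.1 him)
  have hadd : m - Finsupp.single i 1 + Finsupp.single i 1 = m :=
    tsub_add_cancel_of_le (by simpa using h1)
  have := congrArg (MvPolynomial.coeff (m - Finsupp.single i 1)) h0
  rw [MvPolynomial.coeff_pderiv, hadd, MvPolynomial.coeff_zero] at this
  refine (mul_ne_zero (MvPolynomial.mem_support_iff.1 hm) ?_) this
  exact Nat.cast_add_one_ne_zero _

lemma not_dvd_pderiv {σ : Type*} {i : σ} {f : MvPolynomial σ ℂ}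
    (h : MvPolynomial.pderiv i f ≠ 0) : ¬ f ∣ MvPolynomial.pderiv i f := fun hd => by
  have h1 := MvPolynomial.totalDegree_le_of_dvd_of_isDomain hd h
  have h2 := totalDegree_pderiv_add_one_le i h
  omega

lemma infinite_zeroSet {f : MvPolynomial (Fin 2) ℂ} (hy : MvPolynomial.pderiv 1 f ≠ 0) :
    (zeroSet f).Infinite := by
  classical
  set F := toBivariate f with hF
  have hdeg : F.natDegree ≠ 0 := natDegree_toBivariate_ne_zero hy
  have hlc : F.leadingCoeff ≠ 0 := by
    rw [Polynomial.leadingCoeff_ne_zero]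
    rintro h
    simp [h] at hdeg
  have hsub : ({x | F.leadingCoeff.IsRoot x} : Set ℂ)ᶜ ⊆ (fun p : Plane => p 0) '' zeroSet f := by
    intro x hx
    have hx' : Polynomial.evalRingHom x F.leadingCoeff ≠ 0 := hx
    have hd : (F.map (Polynomial.evalRingHom x)).degree ≠ 0 := by
      rw [Polynomial.degree_map_eq_of_leadingCoeff_ne_zero _ hx',
        Polynomial.degree_eq_natDegree (by rintro h; simp [h] at hdeg)]
      exact_mod_cast hdeg
    obtain ⟨y, hy⟩ := IsAlgClosed.exists_root _ hd
    refine ⟨![x, y], ?_, rfl⟩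
    change MvPolynomial.eval _ f = 0
    rw [← evalEval_toBivariate]
    rwa [Polynomial.IsRoot, Polynomial.map_evalRingHom_eval] at hy
  exact Set.Infinite.of_image _
    ((Set.Finite.infinite_compl (Polynomial.finite_setOfPred_isRoot hlc)).mono hsub)

lemma infinite_zeroSet_pderiv_ne_zero {f : MvPolynomial (Fin 2) ℂ} (hf : Irreducible f)
    (hy : MvPolynomial.pderiv 1 f ≠ 0) :
    {p | p ∈ zeroSet f ∧ MvPolynomial.eval p (MvPolynomial.pderiv 1 f) ≠ 0}.Infinite := by
  have hfin := (finite_and_ncard_common_zeros_le hf hy (not_dvd_pderiv hy)).1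
  refine ((infinite_zeroSet hy).sdiff hfin).mono fun p hp => ⟨hp.1, fun h => hp.2 ⟨hp.1, h⟩⟩

/-! ### Lifting curves to the jet space -/

/-- The derivation `f_y ∂_x - f_x ∂_y`, which is tangent to the curves `f = const`; it is `f_y`
times differentiation with respect to `x` along such a curve. -/
noncomputable def tangentDeriv (f g : MvPolynomial (Fin 2) ℂ) : MvPolynomial (Fin 2) ℂ :=
  MvPolynomial.pderiv 1 f * MvPolynomial.pderiv 0 g -
    MvPolynomial.pderiv 0 f * MvPolynomial.pderiv 1 g

/-- If `y = h(x)` is a local solution of `f(x, y) = 0`, then the `i`-th derivative of `h` is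
`jetNum f i / f_y ^ (2 * i)` on the curve. -/
noncomputable def jetNum (f : MvPolynomial (Fin 2) ℂ) : ℕ → MvPolynomial (Fin 2) ℂ
  | 0 => MvPolynomial.X 1
  | i + 1 => MvPolynomial.pderiv 1 f * tangentDeriv f (jetNum f i) -
      MvPolynomial.C (2 * i : ℂ) * jetNum f i * tangentDeriv f (MvPolynomial.pderiv 1 f)

/-- The lift of a point `p` with `f_y(p) ≠ 0` of the curve `f = 0` to the jet space with coordinates
`(x, y, y', y'', …)`: coordinate `0` is `x`, and coordinate `i + 1` is the `i`-th derivative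
of the local solution `y = h(x)`. -/
noncomputable def jet (f : MvPolynomial (Fin 2) ℂ) (p : Plane) : ℕ → ℂ
  | 0 => p 0
  | i + 1 => MvPolynomial.eval p (jetNum f i) /
      MvPolynomial.eval p (MvPolynomial.pderiv 1 f) ^ (2 * i)

/-- The polynomial `Q` on the jet space vanishes on the lift of the curve `f = 0`. -/
def JetVanishes (f : MvPolynomial (Fin 2) ℂ) (Q : MvPolynomial ℕ ℂ) : Prop :=
  ∀ p ∈ zeroSet f, MvPolynomial.eval p (MvPolynomial.pderiv 1 f) ≠ 0 →
    MvPolynomial.eval (jet f p) Q = 0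

lemma totalDegree_tangentDeriv_le (f g : MvPolynomial (Fin 2) ℂ) :
    (tangentDeriv f g).totalDegree ≤ f.totalDegree + g.totalDegree := by
  refine (MvPolynomial.totalDegree_sub _ _).trans (max_le ?_ ?_) <;>
  exact (MvPolynomial.totalDegree_mul _ _).trans
    (add_le_add (totalDegree_pderiv_le _ _) (totalDegree_pderiv_le _ _))

lemma totalDegree_jetNum_le (f : MvPolynomial (Fin 2) ℂ) (i : ℕ) :
    (jetNum f i).totalDegree ≤ 1 + 2 * i * f.totalDegree := by
  induction i with
  | zero => simp [jetNum]
  | succ i ih =>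
    have hy := totalDegree_pderiv_le 1 f
    rw [jetNum]
    refine (MvPolynomial.totalDegree_sub _ _).trans (max_le ?_ ?_)
    · refine (MvPolynomial.totalDegree_mul _ _).trans ?_
      have := totalDegree_tangentDeriv_le f (jetNum f i)
      linarith
    · refine (MvPolynomial.totalDegree_mul _ _).trans ?_
      have h1 := MvPolynomial.totalDegree_mul (MvPolynomial.C (2 * i : ℂ)) (jetNum f i)
      rw [MvPolynomial.totalDegree_C] at h1
      have := totalDegree_tangentDeriv_le f (MvPolynomial.pderiv 1 f)
      linarith

/-- The numerators of the jet coordinates over the common denominator `f_y ^ (2 * k)`. -/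
noncomputable def jetCoordNum (f : MvPolynomial (Fin 2) ℂ) (k : ℕ) : ℕ → MvPolynomial (Fin 2) ℂ
  | 0 => MvPolynomial.X 0 * MvPolynomial.pderiv 1 f ^ (2 * k)
  | i + 1 => jetNum f i * MvPolynomial.pderiv 1 f ^ (2 * (k - i))

lemma totalDegree_jetCoordNum_le (f : MvPolynomial (Fin 2) ℂ) {k i : ℕ} (hi : i < k + 2) :
    (jetCoordNum f k i).totalDegree ≤ 1 + 2 * k * f.totalDegree := by
  have hpow : ∀ n, (MvPolynomial.pderiv 1 f ^ n).totalDegree ≤ n * f.totalDegree := fun n =>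
    (MvPolynomial.totalDegree_pow _ _).trans (Nat.mul_le_mul_left _ (totalDegree_pderiv_le _ _))
  cases i with
  | zero =>
    refine (MvPolynomial.totalDegree_mul _ _).trans ?_
    rw [MvPolynomial.totalDegree_X]
    exact Nat.add_le_add_left (hpow _) _
  | succ i =>
    refine (MvPolynomial.totalDegree_mul _ _).trans
      ((add_le_add (totalDegree_jetNum_le f i) (hpow _)).trans (le_of_eq ?_))
    obtain ⟨j, rfl⟩ := Nat.exists_eq_add_of_le (show i ≤ k by omega)
    rw [Nat.add_sub_cancel_left]
    ring

lemma eval_jetCoordNum (f : MvPolynomial (Fin 2) ℂ) {k i : ℕ} (hi : i < k + 2) {p : Plane}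
    (hp : MvPolynomial.eval p (MvPolynomial.pderiv 1 f) ≠ 0) :
    MvPolynomial.eval p (jetCoordNum f k i) =
      MvPolynomial.eval p (MvPolynomial.pderiv 1 f) ^ (2 * k) * jet f p i := by
  cases i with
  | zero => simp [jetCoordNum, jet, mul_comm]
  | succ i =>
    obtain ⟨j, rfl⟩ := Nat.exists_eq_add_of_le (show i ≤ k by omega)
    simp only [jetCoordNum, jet, map_mul, map_pow, Nat.add_sub_cancel_left]
    field_simp
    ring

/-- Up to a power of `f_y`, a polynomial on the jet space restricts to the lift of the curve
`f = 0` as a polynomial in `x, y` of proportional degree. -/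
lemma exists_eval_eq_eval_jet (f : MvPolynomial (Fin 2) ℂ) {k E : ℕ} {Q : MvPolynomial ℕ ℂ}
    (hvars : ∀ i ∈ Q.vars, i < k + 2) (hdeg : Q.totalDegree ≤ E) :
    ∃ A : MvPolynomial (Fin 2) ℂ, A.totalDegree ≤ (1 + 2 * k * f.totalDegree) * E ∧
      ∀ p, MvPolynomial.eval p (MvPolynomial.pderiv 1 f) ≠ 0 →
        MvPolynomial.eval p A =
          MvPolynomial.eval p (MvPolynomial.pderiv 1 f) ^ (2 * k * E) *
            MvPolynomial.eval (jet f p) Q := by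
  classical
  have hmv : ∀ m ∈ Q.support, ∀ i ∈ m.support, i < k + 2 := fun m hm i hi =>
    hvars i ((MvPolynomial.mem_vars_iff_mem_support _).2 ⟨m, hm, hi⟩)
  have hmd : ∀ m ∈ Q.support, m.degree ≤ E := fun m hm =>
    (MvPolynomial.le_totalDegree hm).trans hdeg
  refine ⟨∑ m ∈ Q.support, MvPolynomial.C (Q.coeff m) *
    ((∏ i ∈ m.support, jetCoordNum f k i ^ m i) *
      MvPolynomial.pderiv 1 f ^ (2 * k * (E - m.degree))), ?_, fun p hp => ?_⟩
  · refine MvPolynomial.totalDegree_finsetSum_le fun m hm => ?_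
    refine (MvPolynomial.totalDegree_mul _ _).trans ?_
    rw [MvPolynomial.totalDegree_C, zero_add]
    refine (MvPolynomial.totalDegree_mul _ _).trans ?_
    have h1 : (∏ i ∈ m.support, jetCoordNum f k i ^ m i).totalDegree ≤
        m.degree * (1 + 2 * k * f.totalDegree) := by
      refine (MvPolynomial.totalDegree_finsetProd _ _).trans ?_
      rw [Finsupp.degree_apply, Finset.sum_mul]
      exact Finset.sum_le_sum fun i hi => (MvPolynomial.totalDegree_pow _ _).trans
        (Nat.mul_le_mul_left _ (totalDegree_jetCoordNum_le f (hmv m hm i hi)))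
    have h2 : (MvPolynomial.pderiv 1 f ^ (2 * k * (E - m.degree))).totalDegree ≤
        (2 * k * (E - m.degree)) * f.totalDegree :=
      (MvPolynomial.totalDegree_pow _ _).trans (Nat.mul_le_mul_left _ (totalDegree_pderiv_le _ _))
    refine (add_le_add h1 h2).trans ?_
    obtain ⟨e, he⟩ := Nat.exists_eq_add_of_le (hmd m hm)
    rw [he, Nat.add_sub_cancel_left]
    nlinarith
  · rw [map_sum, MvPolynomial.eval_eq (jet f p), Finset.mul_sum]
    refine Finset.sum_congr rfl fun m hm => ?_
    obtain ⟨e, he⟩ := Nat.exists_eq_add_of_le (hmd m hm)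
    rw [he, Nat.add_sub_cancel_left]
    have hprod : MvPolynomial.eval p (∏ i ∈ m.support, jetCoordNum f k i ^ m i) =
        MvPolynomial.eval p (MvPolynomial.pderiv 1 f) ^ (2 * k * m.degree) *
          ∏ i ∈ m.support, jet f p i ^ m i := by
      rw [map_prod, pow_mul, Finsupp.degree_apply, ← Finset.prod_pow_eq_pow_sum,
        ← Finset.prod_mul_distrib]
      refine Finset.prod_congr rfl fun i hi => ?_
      rw [map_pow, eval_jetCoordNum f (hmv m hm i hi) hp, mul_pow]
    simp only [map_mul, MvPolynomial.eval_C, map_pow, hprod, mul_add, pow_add]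
    ring

/-- A polynomial on the jet space that does not vanish on the lift of a curve has few zeros
there. -/
lemma finite_and_ncard_jet_zeros_le {f : MvPolynomial (Fin 2) ℂ} (hf : Irreducible f)
    (hy : MvPolynomial.pderiv 1 f ≠ 0) {k E : ℕ} {Q : MvPolynomial ℕ ℂ}
    (hvars : ∀ i ∈ Q.vars, i < k + 2) (hdeg : Q.totalDegree ≤ E) (hQ : ¬ JetVanishes f Q) :
    {p | p ∈ zeroSet f ∧ MvPolynomial.eval p (MvPolynomial.pderiv 1 f) ≠ 0 ∧
        MvPolynomial.eval (jet f p) Q = 0}.Finite ∧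
      {p | p ∈ zeroSet f ∧ MvPolynomial.eval p (MvPolynomial.pderiv 1 f) ≠ 0 ∧
        MvPolynomial.eval (jet f p) Q = 0}.ncard ≤
        2 * f.totalDegree ^ 2 * ((1 + 2 * k * f.totalDegree) * E) := by
  obtain ⟨A, hA, hAe⟩ := exists_eval_eq_eval_jet f hvars hdeg
  have hfA : ¬ f ∣ A := by
    rintro ⟨B, rfl⟩
    refine hQ fun p hp hp' => ?_
    have := hAe p hp'
    rw [map_mul, show MvPolynomial.eval p f = 0 from hp, zero_mul] at this
    exact (mul_eq_zero.1 this.symm).resolve_left (pow_ne_zero _ hp')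
  obtain ⟨hfin, hcard⟩ := finite_and_ncard_common_zeros_le hf hy hfA
  have hsub : {p | p ∈ zeroSet f ∧ MvPolynomial.eval p (MvPolynomial.pderiv 1 f) ≠ 0 ∧
        MvPolynomial.eval (jet f p) Q = 0} ⊆ zeroSet f ∩ zeroSet A := by
    rintro p ⟨h1, h2, h3⟩
    refine ⟨h1, ?_⟩
    change MvPolynomial.eval p A = 0
    rw [hAe p h2, h3, mul_zero]
  exact ⟨hfin.subset hsub, (Set.ncard_le_ncard hsub hfin).trans
    (hcard.trans (Nat.mul_le_mul_left _ hA))⟩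

/-- Interpolation: by a dimension count, some non-zero polynomial of controlled degree on the
space of `k`-jets vanishes at any prescribed points that are few enough. -/
lemma exists_ne_zero_eval_eq_zero {ι : Type*} [Fintype ι] (x : ι → ℕ → ℂ) {k E : ℕ}
    (hE : Fintype.card ι < E ^ (k + 2)) :
    ∃ P : MvPolynomial ℕ ℂ, P ≠ 0 ∧ (∀ i ∈ P.vars, i < k + 2) ∧ P.totalDegree ≤ (k + 2) * E ∧
      ∀ j, MvPolynomial.eval (x j) P = 0 := by
  classical
  let e : (Fin (k + 2) → Fin E) → (Fin (k + 2) →₀ ℕ) := fun m =>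
    Finsupp.equivFunOnFinite.symm fun i => (m i : ℕ)
  have he : Function.Injective e := by
    intro m m' h
    funext i
    exact Fin.ext (DFunLike.congr_fun h i)
  let poly : ((Fin (k + 2) → Fin E) → ℂ) →ₗ[ℂ] MvPolynomial (Fin (k + 2)) ℂ :=
    ∑ m, (MvPolynomial.monomial (e m)).comp (LinearMap.proj m)
  have hpoly : ∀ c, poly c = ∑ m, MvPolynomial.monomial (e m) (c m) := fun c => by simp [poly]
  let L : ((Fin (k + 2) → Fin E) → ℂ) →ₗ[ℂ] (ι → ℂ) :=
    LinearMap.pi fun j => (MvPolynomial.aeval fun i : Fin (k + 2) => x j i).toLinearMap.comp poly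
  have hker : LinearMap.ker L ≠ ⊥ := LinearMap.ker_ne_bot_of_finrank_lt (by simpa using hE)
  obtain ⟨c, hc, hc0⟩ := Submodule.exists_mem_ne_zero_of_ne_bot hker
  have hinj : Function.Injective (fun i : Fin (k + 2) => (i : ℕ)) := Fin.val_injective
  refine ⟨MvPolynomial.rename (fun i : Fin (k + 2) => (i : ℕ)) (poly c), ?_, ?_, ?_, ?_⟩
  · intro h
    rw [map_eq_zero_iff _ (MvPolynomial.rename_injective _ hinj)] at h
    refine hc0 (funext fun m => ?_)
    have := congrArg (MvPolynomial.coeff (e m)) h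
    rw [hpoly, MvPolynomial.coeff_sum] at this
    simpa [MvPolynomial.coeff_monomial, he.eq_iff] using this
  · intro i hi
    obtain ⟨j, -, rfl⟩ := Finset.mem_image.1 (MvPolynomial.vars_rename _ _ hi)
    exact j.2
  · refine (MvPolynomial.totalDegree_rename_le _ _).trans ?_
    rw [hpoly]
    refine MvPolynomial.totalDegree_finsetSum_le fun m _ => ?_
    refine (MvPolynomial.totalDegree_monomial_le _ _).trans ?_
    rw [Finsupp.sum_fintype _ _ (by simp)]
    calc ∑ i, (e m i) ≤ ∑ _i : Fin (k + 2), E :=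
          Finset.sum_le_sum fun i _ => (m i).2.le
      _ = (k + 2) * E := by simp
  · intro j
    have := congrFun (LinearMap.mem_ker.1 hc) j
    rw [MvPolynomial.eval_rename]
    simpa [L, MvPolynomial.aeval_eq_eval, Function.comp_def] using this

/-- Some non-zero polynomial of controlled degree on the space of `k`-jets vanishes on the lifts
of all curves of a finite family: it suffices that it vanishes at more points of each lift
than a polynomial of its degree can when it does not vanish on the whole lift. -/
lemma exists_jetVanishes {ι : Type*} [Fintype ι] (f : ι → MvPolynomial (Fin 2) ℂ) {D k E : ℕ}
    (hf : ∀ j, Irreducible (f j)) (hD : ∀ j, (f j).totalDegree ≤ D)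
    (hy : ∀ j, MvPolynomial.pderiv 1 (f j) ≠ 0)
    (hE : Fintype.card ι * (2 * D ^ 2 * ((1 + 2 * k * D) * ((k + 2) * E)) + 1) < E ^ (k + 2)) :
    ∃ P : MvPolynomial ℕ ℂ, P ≠ 0 ∧ (∀ i ∈ P.vars, i < k + 2) ∧ P.totalDegree ≤ (k + 2) * E ∧
      ∀ j, JetVanishes (f j) P := by
  set M := 2 * D ^ 2 * ((1 + 2 * k * D) * ((k + 2) * E)) + 1
  choose T hT hTcard using fun j =>
    (infinite_zeroSet_pderiv_ne_zero (hf j) (hy j)).exists_subset_card_eq M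
  obtain ⟨P, hP0, hvars, hdeg, hP⟩ := exists_ne_zero_eval_eq_zero
    (fun q : Σ j, T j => jet (f q.1) q.2) (k := k) (E := E) (by simpa [hTcard] using hE)
  refine ⟨P, hP0, hvars, hdeg, fun j => ?_⟩
  by_contra hj
  obtain ⟨hfin, hcard⟩ := finite_and_ncard_jet_zeros_le (hf j) (hy j) hvars hdeg hj
  have hsub := Set.ncard_le_ncard (s := (T j : Set Plane)) (t := {p | p ∈ zeroSet (f j) ∧
      MvPolynomial.eval p (MvPolynomial.pderiv 1 (f j)) ≠ 0 ∧
      MvPolynomial.eval (jet (f j) p) P = 0})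
    (fun p hp => ⟨(hT j hp).1, (hT j hp).2, hP ⟨j, p, hp⟩⟩) hfin
  rw [Set.ncard_coe_finset, hTcard] at hsub
  have hmono : 2 * (f j).totalDegree ^ 2 * ((1 + 2 * k * (f j).totalDegree) * ((k + 2) * E)) ≤
      2 * D ^ 2 * ((1 + 2 * k * D) * ((k + 2) * E)) := by
    have := hD j
    gcongr
  omega

/-! ### Local solutions and implicit differentiation -/

lemma analyticAt_eval {σ : Type*} {a : ℂ → σ → ℂ} {z : ℂ} (ha : ∀ i, AnalyticAt ℂ (a · i) z)
    (Q : MvPolynomial σ ℂ) : AnalyticAt ℂ (fun t => MvPolynomial.eval (a t) Q) z :=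
  AnalyticAt.aeval_mvPolynomial ha Q

/-- First-order Taylor expansion with polynomial remainder terms: `Q(b) - Q(a)` is a combination of
the `b i - a i`, with coefficients that are polynomials in `a` and `b` and specialize to the
partial derivatives of `Q` on the diagonal. -/
lemma exists_eval_sub_eval {σ : Type*} (Q : MvPolynomial σ ℂ) :
    ∃ G : σ → MvPolynomial (σ ⊕ σ) ℂ,
      (∀ i a, MvPolynomial.eval (Sum.elim a a) (G i) =
        MvPolynomial.eval a (MvPolynomial.pderiv i Q)) ∧
      ∀ (s : Finset σ) (a b : σ → ℂ), (∀ i, i ∉ s → a i = b i) →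
        MvPolynomial.eval b Q - MvPolynomial.eval a Q =
          ∑ i ∈ s, (b i - a i) * MvPolynomial.eval (Sum.elim a b) (G i) := by
  classical
  induction Q using MvPolynomial.induction_on with
  | C c => exact ⟨fun _ => 0, by simp, by simp⟩
  | add P Q hP hQ =>
    obtain ⟨G, hG1, hG2⟩ := hP
    obtain ⟨H, hH1, hH2⟩ := hQ
    refine ⟨fun i => G i + H i, fun i a => by simp [hG1, hH1], fun s a b h => ?_⟩
    have h1 := hG2 s a b h
    have h2 := hH2 s a b h
    simp only [map_add, mul_add, Finset.sum_add_distrib, ← h1, ← h2]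
    ring
  | mul_X Q j hQ =>
    obtain ⟨G, hG1, hG2⟩ := hQ
    refine ⟨fun i => MvPolynomial.X (Sum.inl j) * G i +
      if i = j then MvPolynomial.rename Sum.inr Q else 0, fun i a => ?_, fun s a b h => ?_⟩
    · rw [map_add, map_mul, hG1, MvPolynomial.pderiv_mul, MvPolynomial.pderiv_X, map_add, map_mul,
        map_mul]
      rcases eq_or_ne i j with rfl | hij
      · simp [MvPolynomial.eval_rename, Function.comp_def]
        ring
      · simp [hij, Ne.symm hij, mul_comm]
    · have h1 := hG2 s a b h
      have h2 : ∑ i ∈ s, (b i - a i) * MvPolynomial.eval (Sum.elim a b)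
          (if i = j then MvPolynomial.rename Sum.inr Q else 0) =
          (b j - a j) * MvPolynomial.eval b Q := by
        by_cases hj : j ∈ s
        · rw [Finset.sum_eq_single_of_mem j hj (fun i _ hi => by simp [hi])]
          simp [MvPolynomial.eval_rename, Function.comp_def]
        · rw [Finset.sum_eq_zero fun i hi => ?_, h j hj]
          · simp
          · have : i ≠ j := fun h => hj (h ▸ hi)
            simp [this]
      simp only [map_add, map_mul, mul_add, Finset.sum_add_distrib, h2, MvPolynomial.eval_X,
        Sum.elim_inl]
      have h3 : ∑ i ∈ s, (b i - a i) * (a j * MvPolynomial.eval (Sum.elim a b) (G i)) =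
          a j * ∑ i ∈ s, (b i - a i) * MvPolynomial.eval (Sum.elim a b) (G i) := by
        rw [Finset.mul_sum]
        exact Finset.sum_congr rfl fun i _ => by ring
      rw [h3, ← h1]
      ring

lemma hasDerivAt_eval {φ : ℂ → Plane} {φ' : Plane} {t : ℂ}
    (hφ : ∀ i, HasDerivAt (φ · i) (φ' i) t) (g : MvPolynomial (Fin 2) ℂ) :
    HasDerivAt (fun s => MvPolynomial.eval (φ s) g)
      (MvPolynomial.eval (φ t) (MvPolynomial.pderiv 0 g) * φ' 0 +
        MvPolynomial.eval (φ t) (MvPolynomial.pderiv 1 g) * φ' 1) t := by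
  induction g using MvPolynomial.induction_on with
  | C c => simpa using hasDerivAt_const t c
  | add P Q hP hQ =>
    simp only [map_add]
    convert! hP.add hQ using 1
    ring
  | mul_X Q j hQ =>
    simp only [map_mul, MvPolynomial.eval_X, MvPolynomial.pderiv_mul, map_add,
      MvPolynomial.pderiv_X]
    convert! hQ.mul (hφ j) using 1
    fin_cases j <;> simp <;> ring

/-- The function `h` is a holomorphic local solution `y = h(x)` through `p` of the equation
`f(x, y) = 0`. -/
structure IsLocalSolution (f : MvPolynomial (Fin 2) ℂ) (p : Plane) (h : ℂ → ℂ) : Prop where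
  analyticAt : AnalyticAt ℂ h (p 0)
  apply_eq : h (p 0) = p 1
  eval_eq : ∀ᶠ t in 𝓝 (p 0), MvPolynomial.eval ![t, h t] f = 0

lemma exists_isLocalSolution {f : MvPolynomial (Fin 2) ℂ} {p : Plane} (hp : p ∈ zeroSet f)
    (hy : MvPolynomial.eval p (MvPolynomial.pderiv 1 f) ≠ 0) : ∃ h, IsLocalSolution f p h := by
  have hpp : ![p 0, p 1] = p := by ext i; fin_cases i <;> rfl
  let F : ℂ × ℂ → ℂ := fun u => MvPolynomial.eval ![u.1, u.2] f
  have hF : AnalyticAt ℂ F (p 0, p 1) := by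
    refine AnalyticAt.aeval_mvPolynomial (f := fun u : ℂ × ℂ => ![u.1, u.2]) (fun i => ?_) f
    fin_cases i
    · exact analyticAt_fst
    · exact analyticAt_snd
  have hF' : ContDiffAt ℂ 1 F (p 0, p 1) := hF.contDiffAt
  have hFω : ContDiffAt ℂ ⊤ F (p 0, p 1) := hF.contDiffAt
  set c := MvPolynomial.eval p (MvPolynomial.pderiv 1 f) with hc
  have hinv : (fderiv ℂ F (p 0, p 1) ∘L .inr ℂ ℂ ℂ).IsInvertible := by
    refine ⟨ContinuousLinearEquiv.unitsEquivAut ℂ (Units.mk0 c hy), ?_⟩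
    ext
    have h1 : HasDerivAt (fun s : ℂ => ((p 0, s) : ℂ × ℂ)) (0, 1) (p 1) :=
      (hasDerivAt_const _ _).prodMk (hasDerivAt_id _)
    have h2 := (hF.differentiableAt.hasFDerivAt).comp_hasDerivAt (p 1) h1
    have h3 := hasDerivAt_eval (φ := fun s => ![p 0, s]) (φ' := ![0, 1]) (t := p 1) (fun i => by
      fin_cases i
      · exact hasDerivAt_const _ _
      · exact hasDerivAt_id _) f
    have h4 := h2.unique h3
    simp only [hpp] at h4
    simpa using h4.symm
  refine ⟨hFω.implicitFunction (by simp) hinv, ?_, ?_, ?_⟩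
  · exact (hFω.contDiffAt_implicitFunction (by simp) hinv).analyticAt
  · exact hFω.implicitFunction_apply_self (by simp) hinv
  · filter_upwards [hFω.eventually_apply_implicitFunction (by simp) hinv] with t ht
    refine ht.trans ?_
    change MvPolynomial.eval ![p 0, p 1] f = 0
    rw [hpp]
    exact hp

namespace IsLocalSolution

variable {f g : MvPolynomial (Fin 2) ℂ} {p : Plane} {h h' : ℂ → ℂ}

lemma graph_apply_self (hs : IsLocalSolution f p h) : ![p 0, h (p 0)] = p := by
  ext i; fin_cases i
  · rfl
  · exact hs.apply_eq

lemma analyticAt_graph (hs : IsLocalSolution f p h) (i : Fin 2) :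
    AnalyticAt ℂ (fun t => (![t, h t] : Plane) i) (p 0) := by
  fin_cases i
  · exact analyticAt_id
  · exact hs.analyticAt

lemma eventually_eval_ne_zero (hs : IsLocalSolution f p h) {g : MvPolynomial (Fin 2) ℂ}
    (hy : MvPolynomial.eval p g ≠ 0) :
    ∀ᶠ t in 𝓝 (p 0), MvPolynomial.eval ![t, h t] g ≠ 0 := by
  refine (analyticAt_eval hs.analyticAt_graph g).continuousAt.eventually_ne ?_
  rwa [hs.graph_apply_self]

/-- Implicit differentiation: the derivatives of a local solution are the jet coordinates. -/
lemma eventually_iteratedDeriv_eq (hs : IsLocalSolution f p h)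
    (hy : MvPolynomial.eval p (MvPolynomial.pderiv 1 f) ≠ 0) (i : ℕ) :
    ∀ᶠ t in 𝓝 (p 0), iteratedDeriv i h t = jet f ![t, h t] (i + 1) := by
  induction i with
  | zero => exact Filter.Eventually.of_forall fun t => by simp [jet, jetNum]
  | succ i ih =>
    filter_upwards [ih.eventually_nhds, hs.eval_eq.eventually_nhds,
      hs.eventually_eval_ne_zero hy, hs.analyticAt.eventually_analyticAt] with t h1 h2 h3 h4
    have hφ : ∀ j, HasDerivAt (fun t => (![t, h t] : Plane) j) ((![1, deriv h t] : Plane) j) t := by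
      intro j
      fin_cases j
      · exact hasDerivAt_id t
      · exact h4.differentiableAt.hasDerivAt
    have hD := hasDerivAt_eval (φ := fun t => ![t, h t]) hφ
    -- differentiate `f(t, h(t)) = 0`
    have hslope : MvPolynomial.eval ![t, h t] (MvPolynomial.pderiv 0 f) +
        MvPolynomial.eval ![t, h t] (MvPolynomial.pderiv 1 f) * deriv h t = 0 := by
      have := (hD f).unique ((hasDerivAt_const t (0 : ℂ)).congr_of_eventuallyEq h2)
      simpa using this
    have hquot := (hD (jetNum f i)).div ((hD (MvPolynomial.pderiv 1 f)).pow (2 * i))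
      (pow_ne_zero (2 * i) h3)
    rw [iteratedDeriv_succ]
    refine (Filter.EventuallyEq.deriv_eq h1).trans (hquot.deriv.trans ?_)
    have hd : deriv h t = -MvPolynomial.eval ![t, h t] (MvPolynomial.pderiv 0 f) /
        MvPolynomial.eval ![t, h t] (MvPolynomial.pderiv 1 f) := by
      rw [eq_div_iff h3]
      linear_combination hslope
    simp only [jet, jetNum, tangentDeriv, map_sub, map_mul, MvPolynomial.eval_C, hd, Pi.pow_apply,
      Matrix.cons_val_zero, Matrix.cons_val_one]
    rcases i with _ | i
    · simp
      field_simp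
      ring
    · rw [show 2 * (i + 1) - 1 = 2 * i + 1 by omega]
      push_cast
      field_simp
      ring

lemma iteratedDeriv_eq (hs : IsLocalSolution f p h)
    (hy : MvPolynomial.eval p (MvPolynomial.pderiv 1 f) ≠ 0) (i : ℕ) :
    iteratedDeriv i h (p 0) = jet f p (i + 1) := by
  rw [(hs.eventually_iteratedDeriv_eq hy i).self_of_nhds, hs.graph_apply_self]

end IsLocalSolution

/-! ### Arcs of contact between two curves -/

lemma le_analyticOrderAt_of_isBigO {u : ℂ → ℂ} {z : ℂ} (hu : AnalyticAt ℂ u z) {n : ℕ}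
    (h : u =O[𝓝 z] fun t => (t - z) ^ n) : (n : ℕ∞) ≤ analyticOrderAt u z := by
  by_contra hlt
  rw [not_le] at hlt
  obtain ⟨m, hm⟩ := ENat.ne_top_iff_exists.1 (ne_top_of_lt hlt)
  rw [← hm, Nat.cast_lt] at hlt
  obtain ⟨v, hv, hv0, huv⟩ := hu.analyticOrderAt_eq_natCast.1 hm.symm
  apply hv0
  obtain ⟨j, rfl⟩ := Nat.exists_eq_add_of_lt hlt
  -- dividing by `(t - z) ^ m` shows that `v` tends to `0`
  have hO : v =O[𝓝[≠] z] fun t => (t - z) ^ (j + 1) := by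
    obtain ⟨C, hC⟩ := h.bound
    refine Asymptotics.IsBigO.of_bound C ?_
    filter_upwards [hC.filter_mono nhdsWithin_le_nhds, huv.filter_mono nhdsWithin_le_nhds,
      self_mem_nhdsWithin] with t h1 h2 h3
    have ht : 0 < ‖t - z‖ ^ m := pow_pos (norm_pos_iff.2 (sub_ne_zero.2 h3)) m
    rw [h2, smul_eq_mul, norm_mul, norm_pow, add_assoc, pow_add, norm_mul, norm_pow] at h1
    refine le_of_mul_le_mul_left (h1.trans (le_of_eq ?_)) ht
    ring
  have hlim : Filter.Tendsto (fun t => (t - z) ^ (j + 1)) (𝓝[≠] z) (𝓝 0) := by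
    have : Filter.Tendsto (fun t => (t - z) ^ (j + 1)) (𝓝 z) (𝓝 ((z - z) ^ (j + 1))) :=
      Continuous.tendsto (by fun_prop) z
    simpa using this.mono_left nhdsWithin_le_nhds
  exact tendsto_nhds_unique (hv.continuousAt.tendsto.mono_left nhdsWithin_le_nhds)
    (hO.trans_tendsto hlim)

lemma le_analyticOrderAt_finsetSum {ι : Type*} (s : Finset ι) (F : ι → ℂ → ℂ) {z : ℂ} {n : ℕ∞}
    (h : ∀ i ∈ s, n ≤ analyticOrderAt (F i) z) :
    n ≤ analyticOrderAt (fun t => ∑ i ∈ s, F i t) z := by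
  classical
  induction s using Finset.induction_on with
  | empty =>
    simp only [Finset.sum_empty]
    rw [analyticOrderAt_eq_top.2 (Filter.Eventually.of_forall fun _ => rfl)]
    exact le_top
  | insert i s hi ih =>
    simp only [Finset.sum_insert hi]
    exact (le_min (h i (Finset.mem_insert_self _ _))
      (ih fun j hj => h j (Finset.mem_insert_of_mem hj))).trans le_analyticOrderAt_add

lemma le_analyticOrderAt_mul_right {u v : ℂ → ℂ} {z : ℂ} (hu : AnalyticAt ℂ u z)
    (hv : AnalyticAt ℂ v z) {n : ℕ∞} (h : n ≤ analyticOrderAt u z) :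
    n ≤ analyticOrderAt (fun t => u t * v t) z := by
  change n ≤ analyticOrderAt (u * v) z
  rw [analyticOrderAt_mul hu hv]
  exact h.trans le_self_add

lemma analyticOrderAt_mul_of_ne_zero {u v : ℂ → ℂ} {z : ℂ} (hu : AnalyticAt ℂ u z)
    (hv : AnalyticAt ℂ v z) (h0 : v z ≠ 0) :
    analyticOrderAt (fun t => u t * v t) z = analyticOrderAt u z := by
  change analyticOrderAt (u * v) z = _
  rw [analyticOrderAt_mul hu hv, hv.analyticOrderAt_eq_zero.2 h0, add_zero]

/-- Substituting two arcs into the same polynomial gives functions that agree to at least the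
order to which the arcs agree. -/
lemma le_analyticOrderAt_eval_sub {σ : Type*} [Fintype σ] {a b : ℂ → σ → ℂ} {z : ℂ}
    (ha : ∀ i, AnalyticAt ℂ (a · i) z) (hb : ∀ i, AnalyticAt ℂ (b · i) z) {n : ℕ∞}
    (h : ∀ i, n ≤ analyticOrderAt (fun t => b t i - a t i) z) (Q : MvPolynomial σ ℂ) :
    n ≤ analyticOrderAt (fun t => MvPolynomial.eval (b t) Q - MvPolynomial.eval (a t) Q) z := by
  obtain ⟨G, -, hG⟩ := exists_eval_sub_eval Q
  have hab : ∀ i, AnalyticAt ℂ (fun t => (Sum.elim (a t) (b t) : σ ⊕ σ → ℂ) i) z := by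
    rintro (i | i)
    · exact ha i
    · exact hb i
  have heq : (fun t => MvPolynomial.eval (b t) Q - MvPolynomial.eval (a t) Q) = fun t =>
      ∑ i, (b t i - a t i) * MvPolynomial.eval (Sum.elim (a t) (b t)) (G i) := by
    funext t
    exact hG Finset.univ (a t) (b t) fun i hi => absurd (Finset.mem_univ i) hi
  rw [heq]
  exact le_analyticOrderAt_finsetSum _ _ fun i _ =>
    le_analyticOrderAt_mul_right ((hb i).sub (ha i)) (analyticAt_eval hab _) (h i)

/-- The holomorphic arc `φ`, regular at `x` with `φ x = p`, has contact of order `≥ k` with both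
curves `f = 0` and `g = 0`. -/
structure IsContactArc (k : ℕ) (f g : MvPolynomial (Fin 2) ℂ) (p : Plane) (φ : ℂ → Plane) (x : ℂ) :
    Prop where
  analyticAt : ∀ i, AnalyticAt ℂ (φ · i) x
  apply_eq : φ x = p
  deriv_ne_zero : ∃ i, deriv (φ · i) x ≠ 0
  le_left : ((k + 1 : ℕ) : ℕ∞) ≤ analyticOrderAt (fun t => MvPolynomial.eval (φ t) f) x
  le_right : ((k + 1 : ℕ) : ℕ∞) ≤ analyticOrderAt (fun t => MvPolynomial.eval (φ t) g) x

lemma rotate_neg_rotate (θ : ℝ) (p : Plane) : rotate (-θ) (rotate θ p) = p := by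
  have h : (Real.cos θ : ℂ) * Real.cos θ + (Real.sin θ : ℂ) * Real.sin θ = 1 := by
    exact_mod_cast by nlinarith [Real.sin_sq_add_cos_sq θ]
  ext i
  fin_cases i
  · simp only [rotate, Real.cos_neg, Real.sin_neg, Fin.zero_eta, Matrix.cons_val_zero,
      Matrix.cons_val_one, Complex.ofReal_neg]
    linear_combination p 0 * h
  · simp only [rotate, Real.cos_neg, Real.sin_neg, Fin.mk_one, Matrix.cons_val_zero,
      Matrix.cons_val_one, Complex.ofReal_neg]
    linear_combination p 1 * h

/-- Rotating the local graph of a rotated curve back gives a parameterization of the curve. -/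
lemma IsLocalGraph.eventually_mem {γ : Set Plane} {θ : ℝ} {p : Plane} {h : ℂ → ℂ}
    (hp : p ∈ γ) (hg : IsLocalGraph (rotate θ '' γ) (rotate θ p) h) :
    ![rotate θ p 0, h (rotate θ p 0)] = rotate θ p ∧
      ∀ᶠ t in 𝓝 (rotate θ p 0), rotate (-θ) ![t, h t] ∈ γ := by
  have hself : ![rotate θ p 0, h (rotate θ p 0)] = rotate θ p := by
    have := (hg.2.self_of_nhds).1 ⟨p, hp, rfl⟩
    ext i; fin_cases i
    · rfl
    · exact this.symm
  refine ⟨hself, ?_⟩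
  have hcont : ContinuousAt (fun t => (![t, h t] : Plane)) (rotate θ p 0) := by
    refine continuousAt_pi.2 fun i => ?_
    fin_cases i
    · exact continuousAt_id
    · exact hg.1.continuousAt
  have htend : Filter.Tendsto (fun t => (![t, h t] : Plane)) (𝓝 (rotate θ p 0))
      (𝓝 (rotate θ p)) := by
    have := hcont.tendsto
    rwa [hself] at this
  filter_upwards [htend.eventually hg.2] with t ht
  obtain ⟨q, hq, hqt⟩ := ht.2 rfl
  rw [← hqt, rotate_neg_rotate]
  exact hq

lemma TangentToOrder.exists_isContactArc {k : ℕ} {f g : MvPolynomial (Fin 2) ℂ} {p : Plane}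
    (ht : TangentToOrder k (zeroSet f) (zeroSet g) p) :
    ∃ φ x, IsContactArc k f g p φ x := by
  obtain ⟨hf, hg, θ, h, h', hh, hh', hO⟩ := ht
  set x := rotate θ p 0
  obtain ⟨hself, hmem⟩ := hh.eventually_mem hf.1
  obtain ⟨-, hmem'⟩ := hh'.eventually_mem hg.1
  have han : ∀ h : ℂ → ℂ, AnalyticAt ℂ h x →
      ∀ i, AnalyticAt ℂ (fun t => rotate (-θ) ![t, h t] i) x := by
    intro h ha i
    fin_cases i
    · simp only [rotate, Fin.zero_eta, Matrix.cons_val_zero, Matrix.cons_val_one]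
      fun_prop
    · simp only [rotate, Fin.mk_one, Matrix.cons_val_zero, Matrix.cons_val_one]
      fun_prop
  have hsub := le_analyticOrderAt_of_isBigO (hh.1.sub hh'.1) hO
  refine ⟨fun t => rotate (-θ) ![t, h t], x, han h hh.1, ?_, ?_, ?_, ?_⟩
  · rw [hself, rotate_neg_rotate]
  · by_contra! hcon
    have h0 := hcon 0
    have h1 := hcon 1
    have hd := hh.1.differentiableAt.hasDerivAt
    have hd0 : HasDerivAt (fun t => rotate (-θ) ![t, h t] 0)
        ((Real.cos (-θ) : ℂ) * 1 - (Real.sin (-θ) : ℂ) * deriv h x) x :=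
      ((hasDerivAt_id x).const_mul _).sub (hd.const_mul _)
    have hd1 : HasDerivAt (fun t => rotate (-θ) ![t, h t] 1)
        ((Real.sin (-θ) : ℂ) * 1 + (Real.cos (-θ) : ℂ) * deriv h x) x :=
      ((hasDerivAt_id x).const_mul _).add (hd.const_mul _)
    rw [hd0.deriv] at h0
    rw [hd1.deriv] at h1
    have h : (Real.cos (-θ) : ℂ) * Real.cos (-θ) + (Real.sin (-θ) : ℂ) * Real.sin (-θ) = 1 := by
      exact_mod_cast by nlinarith [Real.sin_sq_add_cos_sq (-θ)]
    have : (1 : ℂ) = 0 := by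
      linear_combination (Real.cos (-θ) : ℂ) * h0 + (Real.sin (-θ) : ℂ) * h1 - h
    exact one_ne_zero this
  · rw [analyticOrderAt_eq_top.2 hmem]
    exact le_top
  · -- `g` vanishes on the arc of the second curve, which agrees with `φ` to order `k`
    have key := le_analyticOrderAt_eval_sub (han h' hh'.1) (han h hh.1)
      (n := ((k + 1 : ℕ) : ℕ∞)) (fun i => ?_) g
    · refine key.trans_eq (analyticOrderAt_congr ?_)
      filter_upwards [hmem'] with t ht
      have ht' : MvPolynomial.eval (rotate (-θ) ![t, h' t]) g = 0 := ht
      rw [ht', sub_zero]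
    · have hcoef : ∃ c : ℂ, (fun t => rotate (-θ) ![t, h t] i - rotate (-θ) ![t, h' t] i) =
          fun t => (h t - h' t) * c := by
        fin_cases i
        · refine ⟨-(Real.sin (-θ) : ℂ), funext fun t => ?_⟩
          simp only [rotate, Fin.zero_eta, Matrix.cons_val_zero, Matrix.cons_val_one]
          ring
        · refine ⟨(Real.cos (-θ) : ℂ), funext fun t => ?_⟩
          simp only [rotate, Fin.mk_one, Matrix.cons_val_zero, Matrix.cons_val_one]
          ring
      obtain ⟨c, hc⟩ := hcoef
      rw [hc]
      exact le_analyticOrderAt_mul_right (hh.1.sub hh'.1) analyticAt_const hsub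

namespace IsContactArc

variable {k : ℕ} {f g : MvPolynomial (Fin 2) ℂ} {p : Plane} {φ : ℂ → Plane} {x : ℂ}

lemma symm (hc : IsContactArc k f g p φ x) : IsContactArc k g f p φ x :=
  ⟨hc.analyticAt, hc.apply_eq, hc.deriv_ne_zero, hc.le_right, hc.le_left⟩

lemma gradient_left (hc : IsContactArc k f g p φ x) (hk : 1 ≤ k) :
    MvPolynomial.eval p (MvPolynomial.pderiv 0 f) * deriv (φ · 0) x +
      MvPolynomial.eval p (MvPolynomial.pderiv 1 f) * deriv (φ · 1) x = 0 := by
  have h1 := (natCast_le_analyticOrderAt_iff_iteratedDeriv_eq_zero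
    (analyticAt_eval hc.analyticAt f)).1 hc.le_left 1 (by omega)
  have h2 := hasDerivAt_eval (φ := φ) (φ' := fun i => deriv (φ · i) x)
    (fun i => (hc.analyticAt i).differentiableAt.hasDerivAt) f
  rw [iteratedDeriv_one, h2.deriv, hc.apply_eq] at h1
  exact h1

lemma deriv_zero_ne_zero (hc : IsContactArc k f g p φ x) (hk : 1 ≤ k)
    (hy : MvPolynomial.eval p (MvPolynomial.pderiv 1 f) ≠ 0) : deriv (φ · 0) x ≠ 0 := by
  intro h0
  have h1 := hc.gradient_left hk
  rw [h0, mul_zero, zero_add] at h1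
  obtain ⟨i, hi⟩ := hc.deriv_ne_zero
  fin_cases i
  · exact hi h0
  · exact hi ((mul_eq_zero.1 h1).resolve_left hy)

/-- Curves in contact have vertical tangents simultaneously. -/
lemma pderiv_right_ne_zero (hc : IsContactArc k f g p φ x) (hk : 1 ≤ k)
    (hy : MvPolynomial.eval p (MvPolynomial.pderiv 1 f) ≠ 0)
    (hg : ∃ i, MvPolynomial.eval p (MvPolynomial.pderiv i g) ≠ 0) :
    MvPolynomial.eval p (MvPolynomial.pderiv 1 g) ≠ 0 := by
  intro h0
  have h1 := hc.symm.gradient_left hk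
  rw [h0, zero_mul, add_zero] at h1
  have h2 := (mul_eq_zero.1 h1).resolve_right (hc.deriv_zero_ne_zero hk hy)
  obtain ⟨i, hi⟩ := hg
  fin_cases i
  · exact hi h2
  · exact hi h0

lemma le_analyticOrderAt_graph (hc : IsContactArc k f g p φ x) {h : ℂ → ℂ}
    (hs : IsLocalSolution f p h) (hy : MvPolynomial.eval p (MvPolynomial.pderiv 1 f) ≠ 0) :
    ((k + 1 : ℕ) : ℕ∞) ≤ analyticOrderAt (fun t => φ t 1 - h (φ t 0)) x := by
  obtain ⟨G, hG1, hG2⟩ := exists_eval_sub_eval f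
  have hx0 : φ x 0 = p 0 := by rw [hc.apply_eq]
  have hcomp : AnalyticAt ℂ (fun t => h (φ t 0)) x :=
    AnalyticAt.fun_comp (by rw [hx0]; exact hs.analyticAt) (hc.analyticAt 0)
  have hab : ∀ i, AnalyticAt ℂ
      (fun t => (Sum.elim ![φ t 0, h (φ t 0)] (φ t) : Fin 2 ⊕ Fin 2 → ℂ) i) x := by
    rintro (i | i)
    · fin_cases i
      · exact hc.analyticAt 0
      · exact hcomp
    · exact hc.analyticAt i
  have hGx : MvPolynomial.eval (Sum.elim ![φ x 0, h (φ x 0)] (φ x)) (G 1) ≠ 0 := by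
    rw [hc.apply_eq, hs.graph_apply_self, hG1]
    exact hy
  have hord := analyticOrderAt_mul_of_ne_zero (u := fun t => φ t 1 - h (φ t 0))
    ((hc.analyticAt 1).sub hcomp) (analyticAt_eval hab (G 1)) hGx
  rw [← hord]
  refine hc.le_left.trans_eq (analyticOrderAt_congr ?_)
  have htend : Filter.Tendsto (fun t => φ t 0) (𝓝 x) (𝓝 (p 0)) := by
    have := (hc.analyticAt 0).continuousAt.tendsto
    rwa [hx0] at this
  filter_upwards [htend.eventually hs.eval_eq] with t ht
  have := hG2 {1} ![φ t 0, h (φ t 0)] (φ t) (fun i hi => by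
    fin_cases i
    · rfl
    · simp at hi)
  simpa [ht] using this

/-- Curves in contact to order `k` have the same `k`-jet. -/
lemma jet_eq (hc : IsContactArc k f g p φ x) (hk : 1 ≤ k) (hf : p ∈ zeroSet f) (hg : p ∈ zeroSet g)
    (hyf : MvPolynomial.eval p (MvPolynomial.pderiv 1 f) ≠ 0)
    (hyg : MvPolynomial.eval p (MvPolynomial.pderiv 1 g) ≠ 0) {i : ℕ} (hi : i < k + 2) :
    jet f p i = jet g p i := by
  cases i with
  | zero => rfl
  | succ i =>
    obtain ⟨h, hs⟩ := exists_isLocalSolution hf hyf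
    obtain ⟨h', hs'⟩ := exists_isLocalSolution hg hyg
    have hx0 : φ x 0 = p 0 := by rw [hc.apply_eq]
    have h1 := hc.le_analyticOrderAt_graph hs hyf
    have h2 := hc.symm.le_analyticOrderAt_graph hs' hyg
    have h3 := (le_min h2 h1).trans le_analyticOrderAt_sub
    have h4 : ((fun t => φ t 1 - h' (φ t 0)) - fun t => φ t 1 - h (φ t 0)) =
        (h - h') ∘ fun t => φ t 0 := by
      funext t
      simp
    rw [h4, analyticOrderAt_comp_of_deriv_ne_zero (hc.analyticAt 0) (hc.deriv_zero_ne_zero hk hyf),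
      hx0] at h3
    have h5 := (natCast_le_analyticOrderAt_iff_iteratedDeriv_eq_zero
      (hs.analyticAt.sub hs'.analyticAt)).1 h3 i (by omega)
    rw [iteratedDeriv_sub hs.analyticAt.contDiffAt hs'.analyticAt.contDiffAt, sub_eq_zero,
      hs.iteratedDeriv_eq hyf, hs'.iteratedDeriv_eq hyg] at h5
    exact h5

end IsContactArc

/-! ### Derivatives in the last jet coordinate -/

lemma eval_congr_of_vars {σ : Type*} {Q : MvPolynomial σ ℂ} {a b : σ → ℂ}
    (h : ∀ i ∈ Q.vars, a i = b i) : MvPolynomial.eval a Q = MvPolynomial.eval b Q :=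
  MvPolynomial.eval₂Hom_congr' rfl (fun i hi _ => h i hi) rfl

lemma vars_pderiv_subset {σ : Type*} (i : σ) (Q : MvPolynomial σ ℂ) :
    (MvPolynomial.pderiv i Q).vars ⊆ Q.vars := by
  classical
  intro j hj
  obtain ⟨m, hm, hjm⟩ := (MvPolynomial.mem_vars_iff_mem_support _).1 hj
  refine (MvPolynomial.mem_vars_iff_mem_support _).2 ⟨m + Finsupp.single i 1, ?_, ?_⟩
  · rw [MvPolynomial.mem_support_iff, MvPolynomial.coeff_pderiv] at hm
    exact MvPolynomial.mem_support_iff.2 (left_ne_zero_of_mul hm)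
  · rw [Finsupp.mem_support_iff] at hjm ⊢
    rw [Finsupp.add_apply]
    omega

/-- The jets `(t, h t, h' t, h'' t, …)` of a function of one variable. -/
noncomputable def graphJet (h : ℂ → ℂ) (t : ℂ) : ℕ → ℂ
  | 0 => t
  | i + 1 => iteratedDeriv i h t

lemma analyticAt_graphJet {h : ℂ → ℂ} {z : ℂ} (hh : AnalyticAt ℂ h z) (i : ℕ) :
    AnalyticAt ℂ (graphJet h · i) z := by
  cases i with
  | zero => exact analyticAt_id
  | succ i =>
    change AnalyticAt ℂ (iteratedDeriv i h) z
    rw [iteratedDeriv_eq_iterate]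
    exact hh.iterated_deriv i

namespace IsLocalSolution

variable {f g : MvPolynomial (Fin 2) ℂ} {p : Plane} {h h' : ℂ → ℂ}

lemma graphJet_eq (hs : IsLocalSolution f p h)
    (hy : MvPolynomial.eval p (MvPolynomial.pderiv 1 f) ≠ 0) : graphJet h (p 0) = jet f p := by
  funext i
  cases i with
  | zero => rfl
  | succ i => exact hs.iteratedDeriv_eq hy i

lemma eventually_eval_graphJet_eq_zero (hs : IsLocalSolution f p h)
    (hy : MvPolynomial.eval p (MvPolynomial.pderiv 1 f) ≠ 0) {Q : MvPolynomial ℕ ℂ}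
    (hQ : JetVanishes f Q) : ∀ᶠ t in 𝓝 (p 0), MvPolynomial.eval (graphJet h t) Q = 0 := by
  have hjet : ∀ᶠ t in 𝓝 (p 0), ∀ i ∈ Q.vars, graphJet h t i = jet f ![t, h t] i := by
    refine (Filter.eventually_all_finset _).2 fun i _ => ?_
    cases i with
    | zero => exact Filter.Eventually.of_forall fun t => rfl
    | succ i => exact hs.eventually_iteratedDeriv_eq hy i
  filter_upwards [hjet, hs.eval_eq, hs.eventually_eval_ne_zero hy] with t h1 h2 h3
  rw [eval_congr_of_vars h1]
  exact hQ _ h2 h3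

/-- Distinct irreducible curves have local solutions with distinct germs. -/
lemma analyticOrderAt_sub_ne_top (hf : Irreducible f) (hg : Irreducible g)
    (hne : zeroSet f ≠ zeroSet g) (hyf : MvPolynomial.eval p (MvPolynomial.pderiv 1 f) ≠ 0)
    (hs : IsLocalSolution f p h) (hs' : IsLocalSolution g p h') :
    analyticOrderAt (h' - h) (p 0) ≠ ⊤ := by
  intro htop
  rw [analyticOrderAt_eq_top] at htop
  have hev := (htop.and (hs.eval_eq.and hs'.eval_eq))
  have hinf : {t | (h' - h) t = 0 ∧ MvPolynomial.eval ![t, h t] f = 0 ∧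
      MvPolynomial.eval ![t, h' t] g = 0}.Infinite := infinite_of_mem_nhds (p 0) hev
  have hinj : Set.InjOn (fun t : ℂ => (![t, h t] : Plane)) {t | (h' - h) t = 0 ∧
      MvPolynomial.eval ![t, h t] f = 0 ∧ MvPolynomial.eval ![t, h' t] g = 0} :=
    fun a _ b _ hab => congrFun hab 0
  have hyf0 : MvPolynomial.pderiv 1 f ≠ 0 := fun h0 => hyf (by rw [h0, map_zero])
  refine hne (zeroSet_eq_of_infinite_inter hf hyf0 hg ((hinf.image hinj).mono ?_))
  rintro _ ⟨t, ⟨h1, h2, h3⟩, rfl⟩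
  refine ⟨h2, ?_⟩
  have : h' t = h t := sub_eq_zero.1 h1
  rwa [this] at h3

end IsLocalSolution

/-- The key local fact. Suppose that `Q` vanishes on the lifts of two distinct curves, involves only
jet coordinates up to the `l`-th, and the two curves have the same `k`-jet at `p`.
Then the `l`-th partial derivative of `Q` vanishes at this jet: if `u` is the difference of the local
solutions, then in the first-order expansion of the difference of the values of `Q` the
`l`-th term carries the highest derivative of `u`, hence the lowest order of vanishing, and
nothing else can cancel it. -/
theorem eval_jet_pderiv_eq_zero {f g : MvPolynomial (Fin 2) ℂ} (hf : Irreducible f)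
    (hg : Irreducible g) (hne : zeroSet f ≠ zeroSet g) {p : Plane} (hpf : p ∈ zeroSet f)
    (hpg : p ∈ zeroSet g) (hyf : MvPolynomial.eval p (MvPolynomial.pderiv 1 f) ≠ 0)
    (hyg : MvPolynomial.eval p (MvPolynomial.pderiv 1 g) ≠ 0) {k l : ℕ}
    (hjet : ∀ i < k + 2, jet f p i = jet g p i) (hl0 : l ≠ 0) (hlk : l < k + 2)
    {Q : MvPolynomial ℕ ℂ} (hvars : ∀ i ∈ Q.vars, i ≤ l) (hQf : JetVanishes f Q)
    (hQg : JetVanishes g Q) : MvPolynomial.eval (jet f p) (MvPolynomial.pderiv l Q) = 0 := by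
  obtain ⟨m, rfl⟩ := Nat.exists_eq_succ_of_ne_zero hl0
  obtain ⟨h, hs⟩ := exists_isLocalSolution hpf hyf
  obtain ⟨h', hs'⟩ := exists_isLocalSolution hpg hyg
  have han : AnalyticAt ℂ (h' - h) (p 0) := hs'.analyticAt.sub hs.analyticAt
  have htop := IsLocalSolution.analyticOrderAt_sub_ne_top hf hg hne hyf hs hs'
  obtain ⟨N, hN⟩ := ENat.ne_top_iff_exists.1 htop
  have hkN : k + 1 ≤ N := by
    have : ((k + 1 : ℕ) : ℕ∞) ≤ analyticOrderAt (h' - h) (p 0) := by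
      refine (natCast_le_analyticOrderAt_iff_iteratedDeriv_eq_zero han).2 fun i hi => ?_
      rw [iteratedDeriv_sub hs'.analyticAt.contDiffAt hs.analyticAt.contDiffAt,
        hs.iteratedDeriv_eq hyf, hs'.iteratedDeriv_eq hyg, hjet (i + 1) (by omega), sub_self]
    rw [← hN] at this
    exact_mod_cast this
  -- the coordinates beyond the `l`-th do not enter `Q`, and are taken from the first curve
  let a : ℂ → ℕ → ℂ := graphJet h
  let b : ℂ → ℕ → ℂ := fun t i => if i ≤ m + 1 then graphJet h' t i else graphJet h t i
  have ha : ∀ i, AnalyticAt ℂ (a · i) (p 0) := analyticAt_graphJet hs.analyticAt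
  have hb : ∀ i, AnalyticAt ℂ (b · i) (p 0) := by
    intro i
    by_cases hi : i ≤ m + 1
    · simpa [b, hi] using analyticAt_graphJet hs'.analyticAt i
    · simpa [b, hi] using analyticAt_graphJet hs.analyticAt i
  have hap : a (p 0) = jet f p := hs.graphJet_eq hyf
  have hbp : b (p 0) = jet f p := by
    funext i
    simp only [b]
    split_ifs with hi
    · rw [hs'.graphJet_eq hyg, hjet i (by omega)]
    · rw [hs.graphJet_eq hyf]
  obtain ⟨G, hG1, hG2⟩ := exists_eval_sub_eval Q
  have hab : ∀ i, AnalyticAt ℂ (fun t => (Sum.elim (a t) (b t) : ℕ ⊕ ℕ → ℂ) i) (p 0) := by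
    rintro (i | i)
    · exact ha i
    · exact hb i
  have hord : ∀ j ≤ m, analyticOrderAt (fun t => b t (j + 1) - a t (j + 1)) (p 0) =
      ((N - j : ℕ) : ℕ∞) := by
    intro j hj
    rw [← analyticOrderAt_iterated_deriv han hN (by omega) (by omega), ← iteratedDeriv_eq_iterate]
    refine analyticOrderAt_congr ?_
    filter_upwards [hs.analyticAt.eventually_analyticAt, hs'.analyticAt.eventually_analyticAt]
      with t h1 h2
    rw [iteratedDeriv_sub h2.contDiffAt h1.contDiffAt]
    simp [a, b, hj, graphJet]
  let T : ℕ → ℂ → ℂ := fun i t =>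
    (b t i - a t i) * MvPolynomial.eval (Sum.elim (a t) (b t)) (G i)
  by_contra hcon
  have hTm : analyticOrderAt (T (m + 1)) (p 0) = ((N - m : ℕ) : ℕ∞) := by
    rw [← hord m le_rfl]
    refine analyticOrderAt_mul_of_ne_zero ((hb _).sub (ha _)) (analyticAt_eval hab _) ?_
    rw [hap, hbp, hG1]
    exact hcon
  have hrest : ((N - m + 1 : ℕ) : ℕ∞) ≤
      analyticOrderAt (fun t => ∑ i ∈ Finset.Icc 1 m, T i t) (p 0) := by
    refine le_analyticOrderAt_finsetSum _ _ fun i hi => ?_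
    obtain ⟨hi1, him⟩ := Finset.mem_Icc.1 hi
    obtain ⟨j, rfl⟩ := Nat.exists_eq_add_of_le' hi1
    refine le_analyticOrderAt_mul_right ((hb _).sub (ha _)) (analyticAt_eval hab _) ?_
    refine le_of_le_of_eq ?_ (hord j (by omega)).symm
    exact_mod_cast (show N - m + 1 ≤ N - j by omega)
  have hsum : T (m + 1) =ᶠ[𝓝 (p 0)] -fun t => ∑ i ∈ Finset.Icc 1 m, T i t := by
    filter_upwards [hs.eventually_eval_graphJet_eq_zero hyf hQf,
      hs'.eventually_eval_graphJet_eq_zero hyg hQg] with t h1 h2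
    have hbt : MvPolynomial.eval (b t) Q = 0 := by
      rw [← h2]
      exact eval_congr_of_vars fun i hi => if_pos (hvars i hi)
    have hexp := hG2 (Finset.Icc 1 (m + 1)) (a t) (b t) fun i hi => by
      rcases Nat.eq_zero_or_pos i with rfl | hi0
      · simp [a, b, graphJet]
      · have : ¬ i ≤ m + 1 := fun h => hi (Finset.mem_Icc.2 ⟨hi0, h⟩)
        simp [a, b, this]
    rw [hbt, show MvPolynomial.eval (a t) Q = 0 from h1, sub_zero,
      Finset.sum_Icc_succ_top (by omega)] at hexp
    rw [Pi.neg_apply, eq_neg_iff_add_eq_zero, add_comm]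
    exact hexp.symm
  rw [analyticOrderAt_congr hsum, analyticOrderAt_neg] at hTm
  rw [hTm] at hrest
  have : N - m + 1 ≤ N - m := by exact_mod_cast hrest
  omega

/-- The last jet coordinate that occurs in `Q`; it is `0` when `Q` depends on `x` only. -/
noncomputable def topVar (Q : MvPolynomial ℕ ℂ) : ℕ := Q.vars.sup id

/-- The partial derivative of `Q` in its last jet coordinate; polynomials in `x` only are left
unchanged. -/
noncomputable def topDeriv (Q : MvPolynomial ℕ ℂ) : MvPolynomial ℕ ℂ :=
  if topVar Q = 0 then Q else MvPolynomial.pderiv (topVar Q) Q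

lemma le_topVar {Q : MvPolynomial ℕ ℂ} {i : ℕ} (hi : i ∈ Q.vars) : i ≤ topVar Q :=
  Finset.le_sup (f := id) hi

lemma topVar_mem_vars {Q : MvPolynomial ℕ ℂ} (h : topVar Q ≠ 0) : topVar Q ∈ Q.vars := by
  have hne : Q.vars.Nonempty := by
    by_contra hemp
    rw [Finset.not_nonempty_iff_eq_empty] at hemp
    exact h (by simp [topVar, hemp])
  obtain ⟨i, hi, hmax⟩ := Finset.exists_mem_eq_sup Q.vars hne id
  rw [topVar, hmax]
  exact hi

lemma topDeriv_ne_zero {Q : MvPolynomial ℕ ℂ} (hQ : Q ≠ 0) : topDeriv Q ≠ 0 := by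
  rw [topDeriv]
  split_ifs with h
  · exact hQ
  · exact pderiv_ne_zero_of_mem_vars (topVar_mem_vars h)

lemma vars_topDeriv_subset (Q : MvPolynomial ℕ ℂ) : (topDeriv Q).vars ⊆ Q.vars := by
  rw [topDeriv]
  split_ifs
  · exact subset_rfl
  · exact vars_pderiv_subset _ _

lemma totalDegree_topDeriv_le (Q : MvPolynomial ℕ ℂ) :
    (topDeriv Q).totalDegree ≤ Q.totalDegree - if topVar Q = 0 then 0 else 1 := by
  rw [topDeriv]
  split_ifs with h
  · simp
  · have := totalDegree_pderiv_add_one_le _ (pderiv_ne_zero_of_mem_vars (topVar_mem_vars h))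
    omega

section iterate

variable {P : MvPolynomial ℕ ℂ}

lemma iterate_topDeriv_ne_zero (hP : P ≠ 0) (n : ℕ) : topDeriv^[n] P ≠ 0 := by
  induction n with
  | zero => exact hP
  | succ n ih =>
    rw [Function.iterate_succ_apply']
    exact topDeriv_ne_zero ih

lemma vars_iterate_topDeriv_subset (n : ℕ) : (topDeriv^[n] P).vars ⊆ P.vars := by
  induction n with
  | zero => exact subset_rfl
  | succ n ih =>
    rw [Function.iterate_succ_apply']
    exact (vars_topDeriv_subset _).trans ih

lemma totalDegree_iterate_topDeriv_le (n : ℕ) :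
    (topDeriv^[n] P).totalDegree ≤ P.totalDegree := by
  induction n with
  | zero => exact le_rfl
  | succ n ih =>
    rw [Function.iterate_succ_apply']
    exact (totalDegree_topDeriv_le _).trans ((Nat.sub_le _ _).trans ih)

lemma exists_topVar_iterate_topDeriv_eq_zero (P : MvPolynomial ℕ ℂ) :
    ∃ n, topVar (topDeriv^[n] P) = 0 := by
  by_contra! hcon
  have hdeg : ∀ n, (topDeriv^[n] P).totalDegree + n ≤ P.totalDegree := by
    intro n
    induction n with
    | zero => simp
    | succ n ih =>
      have h1 := totalDegree_pderiv_add_one_le _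
        (pderiv_ne_zero_of_mem_vars (topVar_mem_vars (hcon n)))
      rw [Function.iterate_succ_apply', topDeriv, if_neg (hcon n)]
      omega
  have := hdeg (P.totalDegree + 1)
  omega

end iterate

/-- A non-zero polynomial in `x` alone does not vanish on a curve that is not a vertical line. -/
lemma not_jetVanishes_of_topVar_eq_zero {f : MvPolynomial (Fin 2) ℂ} (hf : Irreducible f)
    (hy : MvPolynomial.pderiv 1 f ≠ 0) {Q : MvPolynomial ℕ ℂ} (hQ : Q ≠ 0) (h0 : topVar Q = 0) :
    ¬ JetVanishes f Q := by
  intro hv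
  have hvars : ∀ i ∈ Q.vars, i = 0 := fun i hi => Nat.le_zero.1 (h0 ▸ le_topVar hi)
  set A : MvPolynomial (Fin 2) ℂ := MvPolynomial.rename (fun _ => 0) Q with hA
  have hAe : ∀ p : Plane, MvPolynomial.eval p A = MvPolynomial.eval (fun _ => p 0) Q := fun p => by
    rw [hA, MvPolynomial.eval_rename]
    rfl
  have hA0 : A ≠ 0 := by
    intro hA0
    refine hQ (MvPolynomial.funext fun y => ?_)
    rw [map_zero, ← map_zero (MvPolynomial.eval (fun _ : Fin 2 => y 0)), ← hA0, hAe]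
    exact eval_congr_of_vars fun i hi => by rw [hvars i hi]
  have hAy : MvPolynomial.pderiv 1 A = 0 := by
    refine MvPolynomial.pderiv_eq_zero_of_notMem_vars fun h1 => ?_
    obtain ⟨j, -, hj⟩ := Finset.mem_image.1 (MvPolynomial.vars_rename _ _ h1)
    exact absurd hj (by decide)
  have hdvd : f ∣ A := by
    by_contra hnd
    refine infinite_zeroSet_pderiv_ne_zero hf hy
      ((finite_and_ncard_common_zeros_le hf hy hnd).1.subset fun p hp => ⟨hp.1, ?_⟩)
    change MvPolynomial.eval p A = 0
    rw [hAe, ← hv p hp.1 hp.2]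
    exact eval_congr_of_vars fun i hi => by rw [hvars i hi]; rfl
  -- compare degrees in `y`
  have hdvd' : toBivariate f ∣ toBivariate A := map_dvd toBivariate hdvd
  have hA0' : toBivariate A ≠ 0 := by simpa using hA0
  have hdeg := Polynomial.natDegree_le_of_dvd hdvd' hA0'
  have hAdeg : (toBivariate A).natDegree = 0 := by
    refine Polynomial.derivative_eq_zero.1 ?_
    have := Polynomial.Bivariate.pderiv_one_equivMvPolynomial (toBivariate A)
    rw [toBivariate, AlgEquiv.apply_symm_apply, hAy] at this
    exact (map_eq_zero_iff _ (Polynomial.Bivariate.equivMvPolynomial ℂ).injective).1 this.symm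
  exact natDegree_toBivariate_ne_zero hy (by omega)

/-! ### Exceptional points and the count -/

/-- The exceptional points of the curve `f = 0` relative to a polynomial `Q` on the jet space: the
points where `f_y` vanishes or where `Q` vanishes at the lifted point. A vertical line
has no exceptional points. -/
def exceptionalSet (f : MvPolynomial (Fin 2) ℂ) (Q : MvPolynomial ℕ ℂ) : Set Plane :=
  {p | MvPolynomial.pderiv 1 f ≠ 0 ∧ p ∈ zeroSet f ∧
    (MvPolynomial.eval p (MvPolynomial.pderiv 1 f) = 0 ∨ MvPolynomial.eval (jet f p) Q = 0)}

lemma finite_and_ncard_exceptionalSet_le {f : MvPolynomial (Fin 2) ℂ} (hf : Irreducible f)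
    {k D E : ℕ} (hD : f.totalDegree ≤ D) {Q : MvPolynomial ℕ ℂ}
    (hvars : ∀ i ∈ Q.vars, i < k + 2) (hdeg : Q.totalDegree ≤ E)
    (hQ : MvPolynomial.pderiv 1 f ≠ 0 → ¬ JetVanishes f Q) :
    (exceptionalSet f Q).Finite ∧
      (exceptionalSet f Q).ncard ≤ 2 * D ^ 2 * D + 2 * D ^ 2 * ((1 + 2 * k * D) * E) := by
  by_cases hy : MvPolynomial.pderiv 1 f = 0
  · have : exceptionalSet f Q = ∅ := by
      ext p
      simp [exceptionalSet, hy]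
    simp [this]
  · obtain ⟨h1, h2⟩ := finite_and_ncard_common_zeros_le hf hy (not_dvd_pderiv hy)
    obtain ⟨h3, h4⟩ := finite_and_ncard_jet_zeros_le hf hy hvars hdeg (hQ hy)
    set S := {p | p ∈ zeroSet f ∧ MvPolynomial.eval p (MvPolynomial.pderiv 1 f) ≠ 0 ∧
      MvPolynomial.eval (jet f p) Q = 0}
    have hsub : exceptionalSet f Q ⊆ (zeroSet f ∩ zeroSet (MvPolynomial.pderiv 1 f)) ∪ S := by
      rintro p ⟨-, hp, h⟩
      by_cases h0 : MvPolynomial.eval p (MvPolynomial.pderiv 1 f) = 0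
      · exact Or.inl ⟨hp, h0⟩
      · exact Or.inr ⟨hp, h0, h.resolve_left h0⟩
    refine ⟨(h1.union h3).subset hsub, (Set.ncard_le_ncard hsub (h1.union h3)).trans
      ((Set.ncard_union_le _ _).trans (add_le_add (h2.trans ?_) (h4.trans ?_)))⟩
    · have := (totalDegree_pderiv_le 1 f).trans hD
      gcongr
    · gcongr

/-- Every curve that is not a vertical line has a rank: a number `n` such that the `n`-th iterated top
derivative of `P` is the first one that does not vanish on the lift of the curve. -/
lemma exists_rank {f : MvPolynomial (Fin 2) ℂ} (hf : Irreducible f)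
    (hy : MvPolynomial.pderiv 1 f ≠ 0) {P : MvPolynomial ℕ ℂ} (hP : P ≠ 0) :
    ∃ n, ¬ JetVanishes f (topDeriv^[n] P) ∧ ∀ m < n, JetVanishes f (topDeriv^[m] P) := by
  classical
  have hex : ∃ n, ¬ JetVanishes f (topDeriv^[n] P) := by
    obtain ⟨n, hn⟩ := exists_topVar_iterate_topDeriv_eq_zero P
    exact ⟨n, not_jetVanishes_of_topVar_eq_zero hf hy (iterate_topDeriv_ne_zero hP n) hn⟩
  exact ⟨Nat.find hex, Nat.find_spec hex, fun m hm => not_not.1 (Nat.find_min hex hm)⟩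

/-- Where two distinct curves have the same `k`-jet, the point is exceptional for the one of smaller
rank, and for both if the ranks agree. -/
lemma mem_exceptionalSet_of_rank_le {f g : MvPolynomial (Fin 2) ℂ} (hf : Irreducible f)
    (hg : Irreducible g) (hne : zeroSet f ≠ zeroSet g) {p : Plane} (hpf : p ∈ zeroSet f)
    (hpg : p ∈ zeroSet g) (hyf : MvPolynomial.eval p (MvPolynomial.pderiv 1 f) ≠ 0)
    (hyg : MvPolynomial.eval p (MvPolynomial.pderiv 1 g) ≠ 0) {k : ℕ}
    (hjet : ∀ i < k + 2, jet f p i = jet g p i) {P : MvPolynomial ℕ ℂ} (hP0 : P ≠ 0)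
    (hvars : ∀ i ∈ P.vars, i < k + 2) (hPf : JetVanishes f P) {m n : ℕ}
    (hm : ¬ JetVanishes f (topDeriv^[m] P)) (hm' : ∀ j < m, JetVanishes f (topDeriv^[j] P))
    (hn' : ∀ j < n, JetVanishes g (topDeriv^[j] P)) (hmn : m ≤ n) :
    p ∈ exceptionalSet f (topDeriv^[m] P) := by
  have hyf0 : MvPolynomial.pderiv 1 f ≠ 0 := fun h0 => hyf (by rw [h0, map_zero])
  refine ⟨hyf0, hpf, Or.inr ?_⟩
  rcases hmn.lt_or_eq with hlt | rfl
  · rw [← hn' m hlt p hpg hyg]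
    exact eval_congr_of_vars fun i hi => hjet i (hvars i (vars_iterate_topDeriv_subset m hi))
  · rcases m with _ | m
    · exact absurd hPf hm
    · have hvf := hm' m (Nat.lt_succ_self m)
      have htop : topVar (topDeriv^[m] P) ≠ 0 := fun h0 =>
        not_jetVanishes_of_topVar_eq_zero hf hyf0 (iterate_topDeriv_ne_zero hP0 m) h0 hvf
      rw [Function.iterate_succ_apply', topDeriv, if_neg htop]
      exact eval_jet_pderiv_eq_zero hf hg hne hpf hpg hyf hyg hjet htop
        (hvars _ (vars_iterate_topDeriv_subset m (topVar_mem_vars htop))) (fun i hi => le_topVar hi)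
        hvf (hn' m (Nat.lt_succ_self m))

/-- To each curve of a finite family one can attach a small set `Z γ` of exceptional points, in such
a way that of two tangent curves at least one is exceptional at the point of tangency, and moreover
two curves tangent to a common third curve are not both non-exceptional. -/
theorem exists_exceptional_points {k D E : ℕ} (hk : 1 ≤ k) (𝒞 : Finset (Set Plane))
    (h𝒞 : ∀ γ ∈ 𝒞, IsIrreducibleCurve γ ∧ ∃ d ≤ D, HasDegree γ d)
    (hE : 𝒞.card * (2 * D ^ 2 * ((1 + 2 * k * D) * ((k + 2) * E)) + 1) < E ^ (k + 2)) :
    ∃ Z : Set Plane → Finset Plane,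
      (∀ γ ∈ 𝒞, (Z γ).card ≤ 2 * D ^ 2 * D + 2 * D ^ 2 * ((1 + 2 * k * D) * ((k + 2) * E))) ∧
      (∀ γ ∈ 𝒞, ∀ γ' ∈ 𝒞, ∀ p, γ ≠ γ' → TangentToOrder k γ γ' p → p ∈ Z γ ∨ p ∈ Z γ') ∧
      (∀ γ₁ ∈ 𝒞, ∀ γ₂ ∈ 𝒞, ∀ γ' ∈ 𝒞, ∀ p, TangentToOrder k γ₁ γ' p → TangentToOrder k γ₂ γ' p →
        p ∉ Z γ₁ → p ∉ Z γ₂ → γ₁ = γ₂) := by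
  classical
  have heq : ∀ γ : 𝒞, ∃ f : MvPolynomial (Fin 2) ℂ,
      Irreducible f ∧ (γ : Set Plane) = zeroSet f ∧ f.totalDegree ≤ D := by
    rintro ⟨γ, hγ⟩
    obtain ⟨hirr, d, hd, hdeg⟩ := h𝒞 γ hγ
    obtain ⟨f, hf, hγf, hfd⟩ := exists_irreducible_equation hirr hdeg
    exact ⟨f, hf, hγf, hfd.le.trans hd⟩
  choose f hf hγ hD using heq
  -- a polynomial vanishing on the lifts of all curves other than vertical lines
  obtain ⟨P, hP0, hvars, hdeg, hP⟩ := exists_jetVanishes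
    (ι := {γ : 𝒞 // MvPolynomial.pderiv 1 (f γ) ≠ 0}) (fun γ => f γ) (D := D) (k := k) (E := E)
    (fun γ => hf γ) (fun γ => hD γ) (fun γ => γ.2)
    ((Nat.mul_le_mul_right _ ((Fintype.card_subtype_le _).trans_eq (by simp))).trans_lt hE)
  have hrank : ∀ γ : 𝒞, ∃ n, MvPolynomial.pderiv 1 (f γ) ≠ 0 →
      ¬ JetVanishes (f γ) (topDeriv^[n] P) ∧ ∀ m < n, JetVanishes (f γ) (topDeriv^[m] P) := by
    intro γ
    by_cases hy : MvPolynomial.pderiv 1 (f γ) = 0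
    · exact ⟨0, fun h => absurd hy h⟩
    · obtain ⟨n, hn⟩ := exists_rank (hf γ) hy hP0
      exact ⟨n, fun _ => hn⟩
  choose r hr using hrank
  let Z' : 𝒞 → Set Plane := fun γ => exceptionalSet (f γ) (topDeriv^[r γ] P)
  have hZ' : ∀ γ, (Z' γ).Finite ∧ (Z' γ).ncard ≤
      2 * D ^ 2 * D + 2 * D ^ 2 * ((1 + 2 * k * D) * ((k + 2) * E)) := fun γ =>
    finite_and_ncard_exceptionalSet_le (hf γ) (hD γ)
      (fun i hi => hvars i (vars_iterate_topDeriv_subset _ hi))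
      ((totalDegree_iterate_topDeriv_le _).trans hdeg) fun hy => (hr γ hy).1
  -- curves with the same `k`-jet
  have hcore : ∀ γ γ' : 𝒞, ∀ p, γ ≠ γ' → p ∈ zeroSet (f γ) → p ∈ zeroSet (f γ') →
      MvPolynomial.eval p (MvPolynomial.pderiv 1 (f γ)) ≠ 0 →
      MvPolynomial.eval p (MvPolynomial.pderiv 1 (f γ')) ≠ 0 →
      (∀ i < k + 2, jet (f γ) p i = jet (f γ') p i) → p ∈ Z' γ ∨ p ∈ Z' γ' := by
    intro γ γ' p hne hp hp' hy hy' hjet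
    have hne' : zeroSet (f γ) ≠ zeroSet (f γ') := by
      rw [← hγ, ← hγ]
      exact fun h => hne (Subtype.ext h)
    have hy0 : MvPolynomial.pderiv 1 (f γ) ≠ 0 := fun h0 => hy (by rw [h0, map_zero])
    have hy0' : MvPolynomial.pderiv 1 (f γ') ≠ 0 := fun h0 => hy' (by rw [h0, map_zero])
    obtain ⟨h1, h2⟩ := hr γ hy0
    obtain ⟨h1', h2'⟩ := hr γ' hy0'
    rcases le_total (r γ) (r γ') with h | h
    · exact Or.inl (mem_exceptionalSet_of_rank_le (hf γ) (hf γ') hne' hp hp' hy hy' hjet hP0 hvars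
        (hP ⟨γ, hy0⟩) h1 h2 h2' h)
    · exact Or.inr (mem_exceptionalSet_of_rank_le (hf γ') (hf γ) hne'.symm hp' hp hy' hy
        (fun i hi => (hjet i hi).symm) hP0 hvars (hP ⟨γ', hy0'⟩) h1' h2' h2 h)
  -- two curves with vertical tangents at `p`
  have hvert : ∀ γ γ' : 𝒞, ∀ p, γ ≠ γ' → p ∈ zeroSet (f γ) → p ∈ zeroSet (f γ') →
      MvPolynomial.eval p (MvPolynomial.pderiv 1 (f γ)) = 0 →
      MvPolynomial.eval p (MvPolynomial.pderiv 1 (f γ')) = 0 → p ∈ Z' γ ∨ p ∈ Z' γ' := by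
    intro γ γ' p hne hp hp' hy hy'
    by_cases h0 : MvPolynomial.pderiv 1 (f γ) = 0
    · by_cases h0' : MvPolynomial.pderiv 1 (f γ') = 0
      · refine absurd (Subtype.ext ?_) hne
        rw [hγ, hγ, zeroSet_eq_vertical_line (hf γ) h0 hp, zeroSet_eq_vertical_line (hf γ') h0' hp']
      · exact Or.inr ⟨h0', hp', Or.inl hy'⟩
    · exact Or.inl ⟨h0, hp, Or.inl hy⟩
  -- tangent curves have the same `k`-jet or both have vertical tangents
  have htang : ∀ γ γ' : 𝒞, ∀ p, TangentToOrder k (γ : Set Plane) γ' p →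
      p ∈ zeroSet (f γ) ∧ p ∈ zeroSet (f γ') ∧
      ((MvPolynomial.eval p (MvPolynomial.pderiv 1 (f γ)) = 0 ∧
          MvPolynomial.eval p (MvPolynomial.pderiv 1 (f γ')) = 0) ∨
        (MvPolynomial.eval p (MvPolynomial.pderiv 1 (f γ)) ≠ 0 ∧
          MvPolynomial.eval p (MvPolynomial.pderiv 1 (f γ')) ≠ 0 ∧
          ∀ i < k + 2, jet (f γ) p i = jet (f γ') p i)) := by
    intro γ γ' p ht
    rw [hγ, hγ] at ht
    obtain ⟨φ, x, hc⟩ := ht.exists_isContactArc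
    have hs := ht.1.exists_pderiv_ne_zero (hf γ)
    have hs' := ht.2.1.exists_pderiv_ne_zero (hf γ')
    refine ⟨ht.1.1, ht.2.1.1, ?_⟩
    by_cases hy : MvPolynomial.eval p (MvPolynomial.pderiv 1 (f γ)) = 0
    · refine Or.inl ⟨hy, ?_⟩
      by_contra hy'
      exact hc.symm.pderiv_right_ne_zero hk hy' hs hy
    · have hy' := hc.pderiv_right_ne_zero hk hy hs'
      exact Or.inr ⟨hy, hy', fun i hi => hc.jet_eq hk ht.1.1 ht.2.1.1 hy hy' hi⟩
  refine ⟨fun γ => if h : γ ∈ 𝒞 then (hZ' ⟨γ, h⟩).1.toFinset else ∅, ?_, ?_, ?_⟩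
  · intro γ h
    simp only [h, dif_pos]
    rw [← Set.ncard_eq_toFinset_card _ (hZ' ⟨γ, h⟩).1]
    exact (hZ' ⟨γ, h⟩).2
  · intro γ h γ' h' p hne ht
    simp only [h, h', dif_pos, Set.Finite.mem_toFinset]
    have hne' : (⟨γ, h⟩ : 𝒞) ≠ ⟨γ', h'⟩ := fun e => hne (congrArg Subtype.val e)
    obtain ⟨hp, hp', ⟨hy, hy'⟩ | ⟨hy, hy', hjet⟩⟩ := htang ⟨γ, h⟩ ⟨γ', h'⟩ p ht
    · exact hvert _ _ p hne' hp hp' hy hy'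
    · exact hcore _ _ p hne' hp hp' hy hy' hjet
  · intro γ₁ h₁ γ₂ h₂ γ' h' p ht₁ ht₂ hZ₁ hZ₂
    simp only [h₁, h₂, dif_pos, Set.Finite.mem_toFinset] at hZ₁ hZ₂
    by_contra hne
    have hne' : (⟨γ₁, h₁⟩ : 𝒞) ≠ ⟨γ₂, h₂⟩ := fun e => hne (congrArg Subtype.val e)
    obtain ⟨hp₁, -, hc₁⟩ := htang ⟨γ₁, h₁⟩ ⟨γ', h'⟩ p ht₁
    obtain ⟨hp₂, -, hc₂⟩ := htang ⟨γ₂, h₂⟩ ⟨γ', h'⟩ p ht₂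
    have : p ∈ Z' ⟨γ₁, h₁⟩ ∨ p ∈ Z' ⟨γ₂, h₂⟩ := by
      rcases hc₁ with ⟨hy₁, hy'⟩ | ⟨hy₁, hy', hjet₁⟩ <;>
      rcases hc₂ with ⟨hy₂, hy''⟩ | ⟨hy₂, hy'', hjet₂⟩
      · exact hvert _ _ p hne' hp₁ hp₂ hy₁ hy₂
      · exact absurd hy' hy''
      · exact absurd hy'' hy'
      · exact hcore _ _ p hne' hp₁ hp₂ hy₁ hy₂ fun i hi => (hjet₁ i hi).trans (hjet₂ i hi).symm
    exact this.elim hZ₁ hZ₂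

/-- Double counting: if every tangency is exceptional for one of the two curves, and a curve has at
most one non-exceptional partner at each point, then the number of incidences with multiplicity is
at most twice the number of exceptional pairs. -/
lemma finite_support_and_finsum_tangencyCount_le {k B : ℕ} (𝒞 : Finset (Set Plane))
    (Z : Set Plane → Finset Plane) (hcard : ∀ γ ∈ 𝒞, (Z γ).card ≤ B)
    (hor : ∀ γ ∈ 𝒞, ∀ γ' ∈ 𝒞, ∀ p, γ ≠ γ' → TangentToOrder k γ γ' p → p ∈ Z γ ∨ p ∈ Z γ')
    (hinj : ∀ γ₁ ∈ 𝒞, ∀ γ₂ ∈ 𝒞, ∀ γ' ∈ 𝒞, ∀ p, TangentToOrder k γ₁ γ' p →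
      TangentToOrder k γ₂ γ' p → p ∉ Z γ₁ → p ∉ Z γ₂ → γ₁ = γ₂) :
    (Function.support (tangencyCount k 𝒞)).Finite ∧
      ∑ᶠ p, tangencyCount k 𝒞 p ≤ 2 * (𝒞.card * B) := by
  classical
  have hle : ∀ p, tangencyCount k 𝒞 p ≤ 2 * (𝒞.filter fun γ => p ∈ Z γ).card := by
    intro p
    set A := 𝒞.filter fun γ => p ∈ Z γ with hA
    set S := 𝒞.filter fun γ => ∃ γ' ∈ 𝒞, γ' ≠ γ ∧ TangentToOrder k γ γ' p with hS
    have hcount : tangencyCount k 𝒞 p = S.card := by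
      rw [tangencyCount, ← Set.ncard_coe_finset]
      congr 1
      ext γ
      simp [hS]
    have hpartner : ∀ γ ∈ S, ∃ γ' ∈ 𝒞, γ' ≠ γ ∧ TangentToOrder k γ γ' p := fun γ hγ =>
      (Finset.mem_filter.1 hγ).2
    choose! partner hp1 hp2 hp3 using hpartner
    have h1 : (S.filter fun γ => p ∈ Z γ).card ≤ A.card :=
      Finset.card_le_card (Finset.filter_subset_filter _ (Finset.filter_subset _ _))
    have h2 : (S.filter fun γ => ¬ p ∈ Z γ).card ≤ A.card := by
      refine Finset.card_le_card_of_injOn partner ?_ ?_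
      · intro γ hγ
        obtain ⟨hγS, hγZ⟩ := Finset.mem_filter.1 hγ
        exact Finset.mem_coe.2 (Finset.mem_filter.2 ⟨hp1 γ hγS,
          (hor γ (Finset.mem_filter.1 hγS).1 _ (hp1 γ hγS) p (hp2 γ hγS).symm
            (hp3 γ hγS)).resolve_left hγZ⟩)
      · intro γ₁ hγ₁ γ₂ hγ₂ he
        obtain ⟨hS₁, hZ₁⟩ := Finset.mem_filter.1 hγ₁
        obtain ⟨hS₂, hZ₂⟩ := Finset.mem_filter.1 hγ₂
        refine hinj γ₁ (Finset.mem_filter.1 hS₁).1 γ₂ (Finset.mem_filter.1 hS₂).1 _ (hp1 γ₁ hS₁) p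
          (hp3 γ₁ hS₁) ?_ hZ₁ hZ₂
        rw [he]
        exact hp3 γ₂ hS₂
    rw [hcount, ← Finset.card_filter_add_card_filter_not (s := S) (fun γ => p ∈ Z γ)]
    omega
  have hsupp : Function.support (tangencyCount k 𝒞) ⊆ (𝒞.biUnion Z : Finset Plane) := by
    intro p hp
    have hpos : (𝒞.filter fun γ => p ∈ Z γ).card ≠ 0 := by
      have := hle p
      have hp' : tangencyCount k 𝒞 p ≠ 0 := hp
      omega
    obtain ⟨γ, hγ⟩ := Finset.card_ne_zero.1 hpos
    obtain ⟨h1, h2⟩ := Finset.mem_filter.1 hγ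
    exact Finset.mem_coe.2 (Finset.mem_biUnion.2 ⟨γ, h1, h2⟩)
  refine ⟨(𝒞.biUnion Z).finite_toSet.subset hsupp, ?_⟩
  rw [finsum_eq_sum_of_support_subset _ hsupp]
  calc ∑ p ∈ 𝒞.biUnion Z, tangencyCount k 𝒞 p
      ≤ ∑ p ∈ 𝒞.biUnion Z, 2 * (𝒞.filter fun γ => p ∈ Z γ).card :=
        Finset.sum_le_sum fun p _ => hle p
    _ = 2 * ∑ γ ∈ 𝒞, ((𝒞.biUnion Z).filter fun p => p ∈ Z γ).card := by
        rw [← Finset.mul_sum]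
        congr 1
        exact Finset.sum_card_bipartiteAbove_eq_sum_card_bipartiteBelow (fun p γ => p ∈ Z γ)
    _ ≤ 2 * ∑ _γ ∈ 𝒞, B := by
        refine Nat.mul_le_mul_left _ (Finset.sum_le_sum fun γ hγ => ?_)
        refine (Finset.card_le_card fun p hp => ?_).trans (hcard γ hγ)
        exact (Finset.mem_filter.1 hp).2
    _ = 2 * (𝒞.card * B) := by simp

lemma exists_lt_pow_and_le_rpow (k : ℕ) {N : ℕ} (hN : 1 ≤ N) :
    ∃ E : ℕ, 1 ≤ E ∧ N < E ^ (k + 1) ∧ (E : ℝ) ≤ 2 * (N : ℝ) ^ (1 / ((k : ℝ) + 1)) := by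
  set y : ℝ := (N : ℝ) ^ (1 / ((k : ℝ) + 1)) with hy
  have hN' : (1 : ℝ) ≤ N := by exact_mod_cast hN
  have hy1 : 1 ≤ y := Real.one_le_rpow hN' (by positivity)
  have hypow : y ^ (k + 1) = N := by
    rw [hy, ← Real.rpow_natCast, ← Real.rpow_mul (by positivity)]
    push_cast
    rw [one_div_mul_cancel (by positivity), Real.rpow_one]
  refine ⟨⌊y⌋₊ + 1, by omega, ?_, ?_⟩
  · have h1 : y < (⌊y⌋₊ + 1 : ℕ) := by exact_mod_cast Nat.lt_floor_add_one y
    have h2 : y ^ (k + 1) < ((⌊y⌋₊ + 1 : ℕ) : ℝ) ^ (k + 1) :=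
      pow_lt_pow_left₀ h1 (by linarith) (by omega)
    rw [hypow] at h2
    exact_mod_cast h2
  · have := Nat.floor_le (show 0 ≤ y by linarith)
    push_cast
    linarith

end PlaneCurve

theorem theorem1 (k : ℕ) (hk : 1 ≤ k) (D : ℕ) :
    ∃ K : ℝ, ∀ 𝒞 : Finset (Set PlaneCurve.Plane),
      (∀ γ ∈ 𝒞, PlaneCurve.IsIrreducibleCurve γ ∧ ∃ d ≤ D, PlaneCurve.HasDegree γ d) →
        (Function.support (PlaneCurve.tangencyCount k 𝒞)).Finite ∧
        ((∑ᶠ p : PlaneCurve.Plane, PlaneCurve.tangencyCount k 𝒞 p : ℕ) : ℝ) ≤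
          K * (𝒞.card : ℝ) ^ (((k : ℝ) + 2) / ((k : ℝ) + 1)) := by
  set c : ℕ := 2 * D ^ 2 * ((1 + 2 * k * D) * (k + 2)) + 1 with hc
  set b : ℕ := 2 * D ^ 2 * D + c with hb
  refine ⟨4 * b * (c : ℝ) ^ (1 / ((k : ℝ) + 1)), fun 𝒞 h𝒞 => ?_⟩
  rcases Nat.eq_zero_or_pos 𝒞.card with h0 | hpos
  · rw [Finset.card_eq_zero] at h0
    subst h0
    have hzero : PlaneCurve.tangencyCount k ∅ = fun _ => 0 := by
      funext p
      simp [PlaneCurve.tangencyCount]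
    rw [hzero]
    constructor
    · simp
    · simp only [finsum_zero, Nat.cast_zero]
      positivity
  set n := 𝒞.card with hn
  obtain ⟨E, hE1, hE, hEle⟩ := PlaneCurve.exists_lt_pow_and_le_rpow k (N := n * c)
    (Nat.mul_pos hpos (Nat.succ_pos _))
  have hinner : 2 * D ^ 2 * ((1 + 2 * k * D) * ((k + 2) * E)) + E = c * E := by
    rw [hc]
    ring
  have hE' : n * (2 * D ^ 2 * ((1 + 2 * k * D) * ((k + 2) * E)) + 1) < E ^ (k + 2) := by
    calc n * (2 * D ^ 2 * ((1 + 2 * k * D) * ((k + 2) * E)) + 1)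
        ≤ n * (c * E) := Nat.mul_le_mul_left _ (by omega)
      _ = n * c * E := by ring
      _ < E ^ (k + 1) * E := Nat.mul_lt_mul_of_pos_right hE hE1
      _ = E ^ (k + 2) := by ring
  obtain ⟨Z, hcard, hor, hinj⟩ := PlaneCurve.exists_exceptional_points hk 𝒞 h𝒞 hE'
  have hB : ∀ γ ∈ 𝒞, (Z γ).card ≤ b * E := by
    intro γ hγ
    have hbE : b * E = 2 * D ^ 2 * D * E + c * E := by
      rw [hb]
      ring
    rw [hbE, ← hinner]
    exact (hcard γ hγ).trans (add_le_add (Nat.le_mul_of_pos_right _ hE1) (Nat.le_add_right _ _))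
  obtain ⟨hfin, hsum⟩ := PlaneCurve.finite_support_and_finsum_tangencyCount_le 𝒞 Z hB hor hinj
  refine ⟨hfin, ?_⟩
  have hn0 : (0 : ℝ) < n := by exact_mod_cast hpos
  have hexp : (n : ℝ) ^ (((k : ℝ) + 2) / ((k : ℝ) + 1)) =
      n * (n : ℝ) ^ (1 / ((k : ℝ) + 1)) := by
    have hk1 : (k : ℝ) + 1 ≠ 0 := by positivity
    rw [show ((k : ℝ) + 2) / ((k : ℝ) + 1) = 1 + 1 / ((k : ℝ) + 1) by field_simp; ring,
      Real.rpow_add hn0, Real.rpow_one]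
  calc ((∑ᶠ p : PlaneCurve.Plane, PlaneCurve.tangencyCount k 𝒞 p : ℕ) : ℝ)
      ≤ ((2 * (n * (b * E)) : ℕ) : ℝ) := by exact_mod_cast hsum
    _ = 2 * (n * (b * (E : ℝ))) := by push_cast; ring
    _ ≤ 2 * (n * (b * (2 * ((n * c : ℕ) : ℝ) ^ (1 / ((k : ℝ) + 1))))) := by gcongr
    _ = 4 * b * (c : ℝ) ^ (1 / ((k : ℝ) + 1)) *
        (n : ℝ) ^ (((k : ℝ) + 2) / ((k : ℝ) + 1)) := by
      rw [hexp, Nat.cast_mul, Real.mul_rpow (by positivity) (by positivity)]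
      ring
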